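/- **Theorem (heterogeneous lower bound with predefined deterministic local functions).** There exist universal constants $c', c_1, c_2, c_3 > 0$ such that the following holds. *Computation model.* Let $n \ge 1$ and let $v_1,\dots,v_n : [0,\infty) \to [0,\infty)$ be almost everywhere continuous and integrable on bounded intervals. Put $V_i(t) = \int_0^t v_i(\tau)\,d\tau$ for $t \in [0,\infty]$. *Protocol.* An algorithm is a sequence $A = \{A^k\}_{k \ge 0}$ of maps $A^k : (\mathbb{R}^d)^k \to [0,\infty)\times\{1,\dots,n\}\times\{0,1\}\times\mathbb{R}^d$. Each oracle $i$ has a state $s_i^k \in [0,\infty)\times\mathbb{R}^d\times\{0,1\}$, with $s_i^0 = (0,0,0)$. For $k = 0,1,2,\dots$ one sets $$(t^{k+1}, i^{k+1}, c^{k+1}, x^k) = A^k(g^1,\dots,g^k), \qquad (s^{k+1}_{i^{k+1}}, g^{k+1}) = O_{i^{k+1}}(t^{k+1}, x^k, s^k_{i^{k+1}}, c^{k+1}),$$ $s^{k+1}_j = s^k_j$ for $j \ne i^{k+1}$, and $t^0 = 0$, where $$O_i(t,x,(s_t,s_x,s_q),c) = \begin{cases} ((t,x,1),\,0), & c=0,\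 s_q=0,\\ ((s_t,s_x,1),\,0), & c=0,\ s_q=1,\ V_i(t)-V_i(s_t)<1,\\ ((0,0,0),\,g_i(s_x;\xi,t)), & c=0,\ s_q=1,\ V_i(t)-V_i(s_t)\ge 1,\\ ((0,0,0),\,0), & c=1,\end{cases}$$ and $\xi$ is a fresh independent draw from a distribution $\mathcal{D}$. The algorithm is zero-respecting ($A \in \mathcal{A}_{\mathrm{zr}}$) if, for all $k$ and all inputs, $\mathrm{supp}(x^k) \subseteq \bigcup_{j=1}^k \mathrm{supp}(g^j)$ and the returned times are non-decreasing in $k$. *Lower bound sequence.* Let $L,\Delta,\varepsilon>0$ and $\sigma \ge 0$ with $\varepsilon < c' L\Delta$. Put $\underline t_0 = 0$ and, for $k \ge 1$, $$\underline t_k = \min\left\{t \ge 0 : \left(\frac1n\sum_{i=1}^n \left\lfloor c_3\,\frac{V_i(t)-V_i(\underline t_{k-1})}{\log(L\Delta/\varepsilon)}\right\rfloor^{-1}\right)^{-1} \ge \max\left\{c_2\,\frac{\sigma^2}{n\varepsilon},\,1\right\}\right\},$$ with the conventions $\min\emptyset = \infty$, $0^{-1}=\infty$, $\infty^{-1}=0$,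 and with negative floors read as $0$. *Claim.* For every sufficiently large dimension $d$ (depending on $n$, $\{v_i\}$, $L,\Delta,\varepsilon,\sigma$) and every $A \in \mathcal{A}_{\mathrm{zr}}$ on $\mathbb{R}^d$ there exist (deterministic) differentiable functions $f_1,\dots,f_n : \mathbb{R}^d \to \mathbb{R}$, a distribution $\mathcal{D}$ and stochastic gradient mappings $g_1,\dots,g_n$ such that 1. $f = \frac1n\sum_{i=1}^n f_i$ satisfies $\|\nabla f(x)-\nabla f(y)\| \le L\|x-y\|$ for all $x,y$, and there is $f^*\in\mathbb{R}$ with $f(x) \ge f^*$ for all $x$ and $f(0)-f^* \le \Delta$; 2. $\mathbb{E}_{\xi\sim\mathcal{D}}[g_i(x;\xi,t)] = \nabla f_i(x)$ and $\mathbb{E}_{\xi\sim\mathcal{D}}\|g_i(x;\xi,t)-\nabla f_i(x)\|^2 \le \sigma^2$ for all $x\in\mathbb{R}^d$, $i$ and $t\ge 0$; 3. $\displaystyle \mathbb{E}\Big[\inf_{k\in S_t}\|\nabla f(x^k)\|^2\Big] > \varepsilon$, where $S_t = \{k \in \{0,1,2,\dots\} : t^k \le t\}$ and $\displaystyle t =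 \frac12\,\underline t_{\left\lfloor c_1\frac{L\Delta/\varepsilon}{\log(L\Delta/\varepsilon)}\right\rfloor}$ (possibly $t = \infty$, in which case $S_t$ contains all $k$). -/

import Mathlib

open scoped NNReal ENNReal

noncomputable section

namespace TimeOracle

/-- `ℝ^d` with the Euclidean norm. -/
abbrev Vec (d : ℕ) : Type := EuclideanSpace ℝ (Fin d)

/-! ### The universal computation model -/

/-- A computation power: non-negative and almost everywhere continuous on `[0, ∞)`, with a finite
integral over every bounded interval (so that `V` below is finite on `[0, ∞)`). Only the values on
`[0, ∞)` matter. -/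
structure IsComputationPower (v : ℝ → ℝ) : Prop where
  nonneg : ∀ τ : ℝ, 0 ≤ τ → 0 ≤ v τ
  ae_continuous : ∀ᵐ τ ∂(MeasureTheory.volume.restrict (Set.Ici (0 : ℝ))),
    ContinuousWithinAt v (Set.Ici 0) τ
  integrableOn : ∀ T : ℝ, MeasureTheory.IntegrableOn v (Set.Icc 0 T)

/-- `V(t) = ∫_0^t v(τ) dτ` for `t ∈ [0, ∞]`. -/
def work (v : ℝ → ℝ) (t : ℝ≥0∞) : ℝ≥0∞ :=
  ∫⁻ τ in {τ : ℝ | 0 ≤ τ ∧ ENNReal.ofReal τ ≤ t}, ENNReal.ofReal (v τ)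

/-! ### Algorithms -/

/-- What an algorithm returns in one iteration: `(t^{k+1}, i^{k+1}, c^{k+1}, x^k)`;
`control = true` stands for `c = 1`. -/
structure Query (n d : ℕ) where
  time : ℝ≥0
  worker : Fin n
  control : Bool
  point : Vec d

/-- `A = {A^k}`, where `A^k` maps `(g^1, …, g^k)` to the next query. -/
abbrev Algorithm (n d : ℕ) : Type := (k : ℕ) → (Fin k → Vec d) → Query n d

/-- The class of zero-respecting algorithms with non-decreasing times. -/
structure IsZeroRespecting {n d : ℕ} (A : Algorithm n d) : Prop where
  supp_subset : ∀ (k : ℕ) (g : Fin k → Vec d) (l : Fin d),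
    (A k g).point l ≠ 0 → ∃ j : Fin k, g j l ≠ 0
  time_mono : ∀ (k : ℕ) (g : Fin (k + 1) → Vec d),
    (A k (fun j => g j.castSucc)).time ≤ (A (k + 1) g).time

/-! ### The oracles and the protocol -/

/-- The state `(s_t, s_x, s_q)` of an oracle; `busy = true` stands for `s_q = 1`. -/
structure OracleState (d : ℕ) where
  time : ℝ≥0
  point : Vec d
  busy : Bool

/-- The state `(0, 0, 0)`. -/
def OracleState.idle (d : ℕ) : OracleState d := ⟨0, 0, false⟩

/-- One call of the oracle of a worker with computation power `v` and stochastic gradient mapping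
`g`, at time `t`, point `x`, state `s`, control variable `c` and with the random draw `ξ`. -/
def oracle {d : ℕ} {Ξ : Type} (v : ℝ → ℝ) (g : Vec d → Ξ → ℝ≥0 → Vec d)
    (t : ℝ≥0) (x : Vec d) (s : OracleState d) (c : Bool) (ξ : Ξ) : OracleState d × Vec d :=
  if c = true then (OracleState.idle d, 0)
  else if s.busy = false then (⟨t, x, true⟩, 0)
  else if work v t - work v s.time < 1 then (s, 0)
  else (OracleState.idle d, g s.point ξ t)

/-- The states `(s^k_i)_i` of the oracles and the vectors `(g^1, …, g^k)` after `k` iterations of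
the time multiple oracles protocol, when `ξ k` is the draw available to the oracle called in
iteration `k`. -/
def run {n d : ℕ} {Ξ : Type} (v : Fin n → ℝ → ℝ) (g : Fin n → Vec d → Ξ → ℝ≥0 → Vec d)
    (A : Algorithm n d) (ξ : ℕ → Ξ) : (k : ℕ) → (Fin n → OracleState d) × (Fin k → Vec d)
  | 0 => (fun _ => OracleState.idle d, Fin.elim0)
  | k + 1 =>
    let h := run v g A ξ k
    let q := A k h.2
    let o := oracle (v q.worker) (g q.worker) q.time q.point (h.1 q.worker) q.control (ξ k)
    (Function.update h.1 q.worker o.1, Fin.snoc h.2 o.2)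

/-- The point `x^k` of the protocol. -/
def iterate {n d : ℕ} {Ξ : Type} (v : Fin n → ℝ → ℝ) (g : Fin n → Vec d → Ξ → ℝ≥0 → Vec d)
    (A : Algorithm n d) (ξ : ℕ → Ξ) (k : ℕ) : Vec d :=
  (A k (run v g A ξ k).2).point

/-- The time `t^k` of the protocol, with `t^0 = 0`. -/
def time {n d : ℕ} {Ξ : Type} (v : Fin n → ℝ → ℝ) (g : Fin n → Vec d → Ξ → ℝ≥0 → Vec d)
    (A : Algorithm n d) (ξ : ℕ → Ξ) : ℕ → ℝ≥0
  | 0 => 0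
  | k + 1 => (A k (run v g A ξ k).2).time

/-- `S_t = {k ∈ ℕ₀ | t^k ≤ t}` for `t ∈ [0, ∞]`. -/
def indicesUpTo {n d : ℕ} {Ξ : Type} (v : Fin n → ℝ → ℝ)
    (g : Fin n → Vec d → Ξ → ℝ≥0 → Vec d) (A : Algorithm n d) (ξ : ℕ → Ξ) (t : ℝ≥0∞) : Set ℕ :=
  {k : ℕ | (time v g A ξ k : ℝ≥0∞) ≤ t}

/-- `inf_{k ∈ S_t} ‖∇f(x^k)‖²`. The index set contains `0`, so it is never empty. -/
def bestSqGrad {n d : ℕ} {Ξ : Type} (v : Fin n → ℝ → ℝ)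
    (g : Fin n → Vec d → Ξ → ℝ≥0 → Vec d) (A : Algorithm n d) (f : Vec d → ℝ) (t : ℝ≥0∞)
    (ξ : ℕ → Ξ) : ℝ :=
  ⨅ k : indicesUpTo v g A ξ t, ‖gradient f (iterate v g A ξ k)‖ ^ 2

/-! ### Function and oracle classes -/

/-- `f = (1/n) ∑ f_i`. -/
def average {n d : ℕ} (f : Fin n → Vec d → ℝ) (x : Vec d) : ℝ := (1 / (n : ℝ)) * ∑ i, f i x

/-- `f` is differentiable and `L`-smooth, bounded from below by some `f^*`, and
`f(0) - f^* ≤ Δ`. -/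
structure InClass {d : ℕ} (L Δ : ℝ) (f : Vec d → ℝ) : Prop where
  differentiable : Differentiable ℝ f
  smooth : ∀ x y : Vec d, ‖gradient f x - gradient f y‖ ≤ L * ‖x - y‖
  gap : ∃ fstar : ℝ, (∀ x : Vec d, fstar ≤ f x) ∧ f 0 - fstar ≤ Δ

/-- `g` is an unbiased stochastic gradient mapping of `f` with variance at most `σ²`, at all points
and times, under `ξ ∼ D`. -/
structure IsStochasticGradient {d : ℕ} {Ξ : Type} [MeasurableSpace Ξ] (σ : ℝ)
    (D : MeasureTheory.Measure Ξ) (f : Vec d → ℝ) (g : Vec d → Ξ → ℝ≥0 → Vec d) : Prop where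
  integrable : ∀ (x : Vec d) (t : ℝ≥0), MeasureTheory.Integrable (fun ξ => g x ξ t) D
  unbiased : ∀ (x : Vec d) (t : ℝ≥0), ∫ ξ, g x ξ t ∂D = gradient f x
  sq_integrable : ∀ (x : Vec d) (t : ℝ≥0),
    MeasureTheory.Integrable (fun ξ => ‖g x ξ t - gradient f x‖ ^ 2) D
  variance_le : ∀ (x : Vec d) (t : ℝ≥0), ∫ ξ, ‖g x ξ t - gradient f x‖ ^ 2 ∂D ≤ σ ^ 2

/-! ### The lower bound sequence -/

/-- `⌊c₃ (V(t) - V(s)) / ℓ⌋`. For `t ≤ s` this is `0`. -/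
def scaledCount (v : ℝ → ℝ) (c₃ ℓ : ℝ) (s : ℝ≥0∞) (t : ℝ≥0) : ℕ :=
  ⌊c₃ * (work v t - work v s).toReal / ℓ⌋₊

/-- `((1/n) ∑ b_i⁻¹)⁻¹` in `[0, ∞]`, with `0⁻¹ = ∞` and `∞⁻¹ = 0`. -/
def harmonicMean {n : ℕ} (b : Fin n → ℕ) : ℝ≥0∞ :=
  ((∑ i, ((b i : ℝ≥0∞))⁻¹) / (n : ℝ≥0∞))⁻¹

/-- The times `t_0 = 0` and
`t_k = min {t ≥ 0 : ((1/n) ∑ ⌊c₃ (V_i(t) - V_i(t_{k-1})) / ℓ⌋⁻¹)⁻¹ ≥ max (c₂ σ² / (n ε)) 1}`,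
where the minimum of the empty set is `∞`. -/
def lowerTime {n : ℕ} (v : Fin n → ℝ → ℝ) (c₂ c₃ ℓ σ ε : ℝ) : ℕ → ℝ≥0∞
  | 0 => 0
  | k + 1 => sInf ((fun t : ℝ≥0 => (t : ℝ≥0∞)) '' {t : ℝ≥0 |
      ENNReal.ofReal (max (c₂ * (σ ^ 2 / (n * ε))) 1) ≤
        harmonicMean (fun i => scaledCount (v i) c₃ ℓ (lowerTime v c₂ c₃ ℓ σ ε k) t)})

end TimeOracle

end

/-! The average function is a chain of links `-gate a * ramp b + sqPos (-b) / 2` between consecutive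
coordinates. Since `gate` and its derivative vanish at `0`, a gradient reveals at most one
coordinate beyond those already found. Since `gate` is at least `1/2` on `[1, ∞)` and the quadratic
term penalises negative coordinates, the gradient stays large until the last coordinate is found
(`quarter_le_norm_chainGrad`). At gradient scale `a² = 32ε`, a number of links of order `LΔ/ε` fits
the smoothness and gap budgets.

With `ℓ = log(LΔ/ε)`, the links are cut into `K` blocks of length `m ≈ 8ℓ`, and block `b` is matched
with the window `(t_b, t_{b+1}]` of the lower bound sequence. Inside a block the workers carry the
links with weights `w_i` of sum `n`, and worker `i` reveals the next coordinate only when a coin of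
heads probability `p_i` allows it; the noise is admissible if `32ε w_i² (1 - p_i) ≤ σ² p_i`. A
worker returns at most `1 + W_i` gradients in a window, `W_i` being its work there (`callCount_le`).
The windows are deterministic, so weights and probabilities can be fixed in advance
(`exists_block_weights`). If some `W_i ≤ ℓ`, that worker alone carries the block, without noise.
Otherwise `w_i` is proportional to `1/W_i`, and the failure of the harmonic mean condition before
`t_{b+1}` controls the coins. Either way at most `2ℓ ≤ m/4` heads are expected.

A Chernoff bound for adaptively tossed coins (`measure_headCount_ge_le`) gives `m` heads in a window
probability at most `exp(-m/4)`. By a union bound, with probability above `1/2` no window uncovers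
more than its block (`discovered_le`), so all squared gradients up to `t_K` are at least `2ε`;
Markov's inequality concludes. -/

noncomputable section

namespace TimeOracle

/-! ### The scalar building blocks -/

/-- The square of the positive part. -/
def sqPos (y : ℝ) : ℝ := max y 0 ^ 2

/-- A smooth gate, zero on `(-∞, 0]` and increasing to `1`. -/
def gate (y : ℝ) : ℝ := sqPos y / (1 + sqPos y)

/-- The derivative of `gate`. -/
def gateDeriv (y : ℝ) : ℝ := 2 * max y 0 / (1 + sqPos y) ^ 2

/-- A bounded, positive, increasing function. -/
def ramp (y : ℝ) : ℝ := Real.arctan y + Real.pi / 2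

/-- The derivative of `ramp`. -/
def rampDeriv (y : ℝ) : ℝ := 1 / (1 + y ^ 2)

lemma sqPos_nonneg (y : ℝ) : 0 ≤ sqPos y := sq_nonneg _

lemma hasDerivAt_sqPos (y : ℝ) : HasDerivAt sqPos (2 * max y 0) y := by
  rw [hasDerivAt_iff_isLittleO]
  refine Asymptotics.IsBigO.trans_isLittleO (g := fun z : ℝ => ‖z - y‖ ^ 2) ?_
    (Asymptotics.isLittleO_pow_sub_sub y one_lt_two)
  refine Asymptotics.IsBigO.of_bound 1 (Filter.Eventually.of_forall fun z => ?_)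
  rw [norm_pow, norm_norm, Real.norm_eq_abs, Real.norm_eq_abs, sq_abs, abs_le]
  simp only [sqPos, smul_eq_mul]
  rcases max_cases y 0 with ⟨h1, h2⟩ | ⟨h1, h2⟩ <;> rcases max_cases z 0 with ⟨h3, h4⟩ | ⟨h3, h4⟩ <;>
    rw [h1, h3] <;> constructor <;> nlinarith [sq_nonneg (z - y)]

lemma gate_nonneg (y : ℝ) : 0 ≤ gate y :=
  div_nonneg (sqPos_nonneg y) (by linarith [sqPos_nonneg y])

lemma gate_le_one (y : ℝ) : gate y ≤ 1 := by
  have := sqPos_nonneg y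
  rw [gate, div_le_one (by linarith)]
  linarith

lemma half_le_gate {y : ℝ} (hy : 1 ≤ y) : 1 / 2 ≤ gate y := by
  have h : 1 ≤ sqPos y := by
    rw [sqPos, max_eq_left (by linarith)]
    nlinarith
  rw [gate, div_le_div_iff₀ two_pos (by linarith)]
  linarith

lemma gate_zero : gate 0 = 0 := by simp [gate, sqPos]

lemma gateDeriv_nonneg (y : ℝ) : 0 ≤ gateDeriv y := by
  have := le_max_right y 0
  unfold gateDeriv
  positivity

lemma gateDeriv_zero : gateDeriv 0 = 0 := by simp [gateDeriv]

lemma gateDeriv_le_one (y : ℝ) : gateDeriv y ≤ 1 := by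
  have h := le_max_right y 0
  unfold gateDeriv sqPos
  generalize max y 0 = p at h
  rw [div_le_one (by positivity)]
  nlinarith [sq_nonneg (p - 1), sq_nonneg (p ^ 2)]

lemma hasDerivAt_gate (y : ℝ) : HasDerivAt gate (gateDeriv y) y := by
  have h := hasDerivAt_sqPos y
  have hn : 1 + sqPos y ≠ 0 := by linarith [sqPos_nonneg y]
  refine (h.div (h.const_add 1) hn).congr_deriv ?_
  unfold gateDeriv
  ring

lemma abs_gate_sub_le (a b : ℝ) : |gate a - gate b| ≤ |a - b| := by
  have := Convex.norm_image_sub_le_of_norm_hasDerivWithin_le (f := gate) (f' := gateDeriv)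
    (s := Set.univ) (C := 1) (x := b) (y := a) (fun x _ => (hasDerivAt_gate x).hasDerivWithinAt)
    (fun x _ => by
      rw [Real.norm_eq_abs, abs_of_nonneg (gateDeriv_nonneg x)]
      exact gateDeriv_le_one x)
    convex_univ trivial trivial
  simpa using this

/-- `gateDeriv` has a kink at `0`, so its derivative is avoided: positive parts are 1-Lipschitz, and
for `p, q ≥ 0` the difference factors as `2 * (p - q)` times a quotient of absolute value at most
`1`. -/
lemma abs_gateDeriv_sub_le (a b : ℝ) : |gateDeriv a - gateDeriv b| ≤ 2 * |a - b| := by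
  have hab : |max a 0 - max b 0| ≤ |a - b| := abs_max_sub_max_le_abs a b 0
  refine le_trans ?_ (mul_le_mul_of_nonneg_left hab zero_le_two)
  have hp := le_max_right a 0
  have hq := le_max_right b 0
  unfold gateDeriv sqPos
  generalize max a 0 = p at hp
  generalize max b 0 = q at hq
  have hD : 0 < (1 + p ^ 2) ^ 2 * (1 + q ^ 2) ^ 2 := by positivity
  have hpq := mul_nonneg hp hq
  have e : 2 * p / (1 + p ^ 2) ^ 2 - 2 * q / (1 + q ^ 2) ^ 2
      = 2 * (p - q) * ((1 - 2 * (p * q) - p * q * (p ^ 2 + p * q + q ^ 2)) /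
        ((1 + p ^ 2) ^ 2 * (1 + q ^ 2) ^ 2)) := by
    field_simp
    ring
  rw [e, abs_mul, abs_mul, abs_two]
  refine mul_le_of_le_one_right (by positivity) ?_
  have hz : 0 ≤ p * q * (p ^ 2 + p * q + q ^ 2) := by positivity
  have hle : 1 + 2 * (p * q) + p * q * (p ^ 2 + p * q + q ^ 2) ≤
      (1 + p ^ 2) ^ 2 * (1 + q ^ 2) ^ 2 := by
    have h1 : 2 * (p * q) ≤ p ^ 2 + q ^ 2 := by nlinarith [sq_nonneg (p - q)]
    have h2 : p * q * (p ^ 2 + p * q + q ^ 2) ≤ p ^ 4 + q ^ 4 + 4 * (p * q) ^ 2 := by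
      nlinarith [sq_nonneg (p ^ 2 - p * q), sq_nonneg (q ^ 2 - p * q), sq_nonneg (p * q),
        sq_nonneg (p ^ 2), sq_nonneg (q ^ 2)]
    have h3 : 0 ≤ p ^ 4 * q ^ 4 + 2 * (p ^ 4 * q ^ 2) + 2 * (p ^ 2 * q ^ 4) + p ^ 2 + q ^ 2 := by
      positivity
    nlinarith
  rw [abs_div, abs_of_pos hD, div_le_one hD, abs_le]
  constructor <;> linarith

lemma ramp_nonneg (y : ℝ) : 0 ≤ ramp y := by
  have := Real.neg_pi_div_two_lt_arctan y
  unfold ramp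
  linarith

lemma ramp_le_four (y : ℝ) : ramp y ≤ 4 := by
  have h1 := Real.arctan_lt_pi_div_two y
  have h2 := Real.pi_lt_four
  unfold ramp
  linarith

lemma hasDerivAt_ramp (y : ℝ) : HasDerivAt ramp (rampDeriv y) y :=
  (Real.hasDerivAt_arctan y).add_const _

lemma rampDeriv_nonneg (y : ℝ) : 0 ≤ rampDeriv y := by
  unfold rampDeriv
  positivity

lemma rampDeriv_le_one (y : ℝ) : rampDeriv y ≤ 1 := by
  unfold rampDeriv
  rw [div_le_one (by positivity)]
  nlinarith [sq_nonneg y]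

lemma half_le_rampDeriv {y : ℝ} (hy : |y| ≤ 1) : 1 / 2 ≤ rampDeriv y := by
  unfold rampDeriv
  rw [div_le_div_iff₀ two_pos (by positivity)]
  have := (sq_le_one_iff_abs_le_one y).2 hy
  linarith

lemma abs_ramp_sub_le (a b : ℝ) : |ramp a - ramp b| ≤ |a - b| := by
  have := Convex.norm_image_sub_le_of_norm_hasDerivWithin_le (f := ramp) (f' := rampDeriv)
    (s := Set.univ) (C := 1) (x := b) (y := a) (fun x _ => (hasDerivAt_ramp x).hasDerivWithinAt)
    (fun x _ => by
      rw [Real.norm_eq_abs, abs_of_nonneg (rampDeriv_nonneg x)]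
      exact rampDeriv_le_one x)
    convex_univ trivial trivial
  simpa using this

lemma abs_rampDeriv_sub_le (a b : ℝ) : |rampDeriv a - rampDeriv b| ≤ |a - b| := by
  unfold rampDeriv
  have hD : 0 < (1 + a ^ 2) * (1 + b ^ 2) := by positivity
  have e : 1 / (1 + a ^ 2) - 1 / (1 + b ^ 2) =
      (a - b) * (-(a + b) / ((1 + a ^ 2) * (1 + b ^ 2))) := by
    field_simp
    ring
  rw [e, abs_mul]
  refine mul_le_of_le_one_right (abs_nonneg _) ?_
  rw [abs_div, abs_of_pos hD, div_le_one hD, abs_le]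
  constructor <;> nlinarith [sq_nonneg (a - 1), sq_nonneg (b - 1), sq_nonneg (a + 1),
    sq_nonneg (b + 1), sq_nonneg (a * b)]

/-! ### The chain function -/

/-- The coordinates of `x`, preceded by a virtual coordinate `1` and followed by zeros. -/
def ext {d : ℕ} (x : Vec d) : ℕ → ℝ
  | 0 => 1
  | j + 1 => if h : j < d then x ⟨j, h⟩ else 0

/-- One link of the chain. -/
def link (a b : ℝ) : ℝ := -(gate a * ramp b) + sqPos (-b) / 2

/-- The weighted chain of links between consecutive coordinates. -/
def chain {d : ℕ} (w : ℕ → ℝ) (x : Vec d) : ℝ :=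
  ∑ j ∈ Finset.range d, w j * link (ext x j) (ext x (j + 1))

/-- The gradient of `chain w` when `w d = 0`. -/
def chainGrad {d : ℕ} (w : ℕ → ℝ) (x : Vec d) : Vec d :=
  WithLp.toLp 2 fun j : Fin d =>
    w j * (-(gate (ext x j) * rampDeriv (ext x (j + 1))) - max (-ext x (j + 1)) 0)
      - w (j + 1) * (gateDeriv (ext x (j + 1)) * ramp (ext x (j + 2)))

lemma chainGrad_apply {d : ℕ} (w : ℕ → ℝ) (x : Vec d) (j : Fin d) :
    chainGrad w x j =
      w j * (-(gate (ext x j) * rampDeriv (ext x (j + 1))) - max (-ext x (j + 1)) 0)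
        - w (j + 1) * (gateDeriv (ext x (j + 1)) * ramp (ext x (j + 2))) := rfl

/-- The derivative of `ext · j`. -/
def extDeriv {d : ℕ} : ℕ → (Vec d →L[ℝ] ℝ)
  | 0 => 0
  | j + 1 => if h : j < d then EuclideanSpace.proj ⟨j, h⟩ else 0

lemma hasFDerivAt_ext {d : ℕ} (x : Vec d) (j : ℕ) :
    HasFDerivAt (fun y : Vec d => ext y j) (extDeriv j) x := by
  cases j with
  | zero => exact hasFDerivAt_const _ _
  | succ j =>
    by_cases h : j < d
    · simp only [ext, extDeriv, h, dif_pos]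
      exact (EuclideanSpace.proj (𝕜 := ℝ) (⟨j, h⟩ : Fin d)).hasFDerivAt
    · simp only [ext, extDeriv, h, dif_neg, not_false_eq_true]
      exact hasFDerivAt_const _ _

lemma hasFDerivAt_link {d : ℕ} (x : Vec d) (j : ℕ) :
    HasFDerivAt (fun y : Vec d => link (ext y j) (ext y (j + 1)))
      ((-(gateDeriv (ext x j) * ramp (ext x (j + 1)))) • extDeriv j +
        (-(gate (ext x j) * rampDeriv (ext x (j + 1))) - max (-ext x (j + 1)) 0) •
          extDeriv (j + 1)) x := by
  have h1 := (hasDerivAt_gate (ext x j)).comp_hasFDerivAt x (hasFDerivAt_ext x j)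
  have h2 := (hasDerivAt_ramp (ext x (j + 1))).comp_hasFDerivAt x (hasFDerivAt_ext x (j + 1))
  have h3 := ((hasDerivAt_sqPos (-ext x (j + 1))).comp_hasFDerivAt x
    (hasFDerivAt_ext x (j + 1)).neg).mul_const (1 / 2)
  have h := (h1.mul h2).neg.add h3
  refine (h.congr_fderiv ?_).congr_of_eventuallyEq (Filter.Eventually.of_forall fun y => ?_)
  · ext z
    simp
    ring
  · simp [link]
    ring

theorem hasGradientAt_chain {d : ℕ} {w : ℕ → ℝ} (hw : w d = 0) (x : Vec d) :
    HasGradientAt (chain w) (chainGrad w x) x := by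
  rw [hasGradientAt_iff_hasFDerivAt]
  have h := HasFDerivAt.fun_sum (u := Finset.range d) (x := x)
    (A := fun j (y : Vec d) => w j * link (ext y j) (ext y (j + 1)))
    (fun j _ => (hasFDerivAt_link x j).const_mul (w j))
  refine h.congr_fderiv ?_
  ext z
  simp only [InnerProductSpace.toDual_apply_apply, PiLp.inner_apply]
  have hz : ∀ j : Fin d, extDeriv (d := d) (j + 1) z = z j := fun j => by simp [extDeriv]
  simp only [sum_apply, smul_apply,
    add_apply, smul_eq_mul, mul_add, Finset.sum_add_distrib]
  -- Index shift: the term `j = 0` vanishes because the virtual coordinate is constant, the term `j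
  -- = d` because `w d = 0`.
  have e1 : ∑ j ∈ Finset.range d,
      w j * (-(gateDeriv (ext x j) * ramp (ext x (j + 1))) * extDeriv j z) =
      ∑ j ∈ Finset.range d,
        w (j + 1) * (-(gateDeriv (ext x (j + 1)) * ramp (ext x (j + 2))) *
          extDeriv (d := d) (j + 1) z) := by
    have a := Finset.sum_range_succ (fun j => w j *
      (-(gateDeriv (ext x j) * ramp (ext x (j + 1))) * extDeriv j z)) d
    have b := Finset.sum_range_succ' (fun j => w j *
      (-(gateDeriv (ext x j) * ramp (ext x (j + 1))) * extDeriv j z)) d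
    simp only [hw, zero_mul, add_zero] at a
    simp only [extDeriv, zero_apply, mul_zero, add_zero] at b
    rw [← a]
    exact b
  rw [e1, ← Finset.sum_add_distrib, Finset.sum_range]
  refine Finset.sum_congr rfl fun j _ => ?_
  rw [hz, chainGrad_apply]
  simp
  ring

lemma neg_four_le_link (a b : ℝ) : -4 ≤ link a b := by
  have h1 := mul_le_mul (gate_le_one a) (ramp_le_four b) (ramp_nonneg b) zero_le_one
  have h2 := sqPos_nonneg (-b)
  unfold link
  linarith

/-- The weights of the first `T` links. -/
def firstWeights (T : ℕ) (j : ℕ) : ℝ := if j < T then 1 else 0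

lemma chain_firstWeights_ge {d T : ℕ} (hT : T ≤ d) (x : Vec d) :
    -(4 * (T : ℝ)) ≤ chain (firstWeights T) x := by
  have h : ∑ j ∈ Finset.range d, firstWeights T j * (-4) ≤ chain (firstWeights T) x := by
    refine Finset.sum_le_sum fun j _ => mul_le_mul_of_nonneg_left (neg_four_le_link _ _) ?_
    unfold firstWeights
    split_ifs <;> norm_num
  refine le_trans (le_of_eq ?_) h
  rw [← Finset.sum_mul]
  have : ∑ j ∈ Finset.range d, firstWeights T j = T := by
    simp only [firstWeights]
    rw [← Finset.sum_filter]
    have : (Finset.range d).filter (· < T) = Finset.range T := by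
      ext j
      simp
      omega
    rw [this]
    simp
  rw [this]
  ring

lemma chain_firstWeights_zero_le {d T : ℕ} : chain (firstWeights T) (0 : Vec d) ≤ 0 := by
  refine Finset.sum_nonpos fun j _ => ?_
  refine mul_nonpos_of_nonneg_of_nonpos ?_ ?_
  · unfold firstWeights
    split_ifs <;> norm_num
  · have : ext (0 : Vec d) (j + 1) = 0 := by simp [ext]
    rw [this, link]
    have h := mul_nonneg (gate_nonneg (ext (0 : Vec d) j)) (ramp_nonneg 0)
    have : sqPos (-0) = 0 := by simp [sqPos]
    rw [this]
    linarith

lemma abs_mul_sub_mul_le (a b a' b' : ℝ) :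
    |a * b - a' * b'| ≤ |a - a'| * |b| + |a'| * |b - b'| := by
  have : a * b - a' * b' = (a - a') * b + a' * (b - b') := by ring
  rw [this, ← abs_mul, ← abs_mul]
  exact abs_add_le _ _

/-- The constant `10` is `1 + 8 + 1`: `rampDeriv` is 1-Lipschitz, `gateDeriv` is 2-Lipschitz and
multiplied by `ramp ≤ 4`, and the positive part is 1-Lipschitz. -/
lemma abs_chainGrad_sub_le {d T : ℕ} (x y : Vec d) (j : Fin d) :
    |chainGrad (firstWeights T) x j - chainGrad (firstWeights T) y j| ≤
      |ext x j - ext y j| + 10 * |ext x (j + 1) - ext y (j + 1)| +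
        |ext x (j + 2) - ext y (j + 2)| := by
  rw [chainGrad_apply, chainGrad_apply]
  generalize ext x j = a
  generalize ext x (j + 1) = b
  generalize ext x (j + 2) = c
  generalize ext y j = a'
  generalize ext y (j + 1) = b'
  generalize ext y (j + 2) = c'
  have hA : |gate a * rampDeriv b - gate a' * rampDeriv b'| ≤ |a - a'| + |b - b'| := by
    refine (abs_mul_sub_mul_le _ _ _ _).trans (add_le_add ?_ ?_)
    · rw [abs_of_nonneg (rampDeriv_nonneg b)]
      exact (mul_le_of_le_one_right (abs_nonneg _) (rampDeriv_le_one b)).trans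
        (abs_gate_sub_le _ _)
    · rw [abs_of_nonneg (gate_nonneg a')]
      exact (mul_le_of_le_one_left (abs_nonneg _) (gate_le_one a')).trans
        (abs_rampDeriv_sub_le _ _)
  have hB : |gateDeriv b * ramp c - gateDeriv b' * ramp c'| ≤ 8 * |b - b'| + |c - c'| := by
    refine (abs_mul_sub_mul_le _ _ _ _).trans (add_le_add ?_ ?_)
    · rw [abs_of_nonneg (ramp_nonneg c)]
      have := mul_le_mul (abs_gateDeriv_sub_le b b') (ramp_le_four c) (ramp_nonneg c)
        (by positivity)
      linarith
    · rw [abs_of_nonneg (gateDeriv_nonneg b')]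
      exact (mul_le_of_le_one_left (abs_nonneg _) (gateDeriv_le_one b')).trans
        (abs_ramp_sub_le _ _)
  have hR : |max (-b) 0 - max (-b') 0| ≤ |b - b'| := by
    refine (abs_max_sub_max_le_abs _ _ _).trans (le_of_eq ?_)
    rw [neg_sub_neg, abs_sub_comm]
  have hw : ∀ i, 0 ≤ firstWeights T i ∧ firstWeights T i ≤ 1 := fun i => by
    unfold firstWeights
    split_ifs <;> norm_num
  have hwm : ∀ (i : ℕ) (r : ℝ), |firstWeights T i * r| ≤ |r| := fun i r => by
    rw [abs_mul, abs_of_nonneg (hw i).1]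
    exact mul_le_of_le_one_left (abs_nonneg _) (hw i).2
  have e : ∀ u u' : ℝ, u * (-(gate a * rampDeriv b) - max (-b) 0) - u' * (gateDeriv b * ramp c) -
      (u * (-(gate a' * rampDeriv b') - max (-b') 0) - u' * (gateDeriv b' * ramp c')) =
      -(u * (gate a * rampDeriv b - gate a' * rampDeriv b')) +
        -(u * (max (-b) 0 - max (-b') 0)) +
        -(u' * (gateDeriv b * ramp c - gateDeriv b' * ramp c')) := fun u u' => by ring
  rw [e]
  refine (abs_add_three _ _ _).trans ?_
  rw [abs_neg, abs_neg, abs_neg]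
  have k1 := (hwm j _).trans hA
  have k2 := (hwm j _).trans hR
  have k3 := (hwm (j + 1) _).trans hB
  linarith

/-- The virtual coordinate cancels and the padding is zero. Arbitrary `N` is needed for the shifted
sums in the Lipschitz bound. -/
lemma sum_ext_sub_sq_le {d : ℕ} (x y : Vec d) (N : ℕ) :
    ∑ j ∈ Finset.range N, (ext x j - ext y j) ^ 2 ≤ ‖x - y‖ ^ 2 := by
  have h0 : ∑ j ∈ Finset.range N, (ext x j - ext y j) ^ 2 ≤
      ∑ j ∈ Finset.range (N + d + 1), (ext x j - ext y j) ^ 2 :=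
    Finset.sum_le_sum_of_subset_of_nonneg (Finset.range_subset_range.2 (by omega))
      fun _ _ _ => sq_nonneg _
  refine h0.trans (le_of_eq ?_)
  rw [Finset.sum_range_succ', EuclideanSpace.norm_sq_eq, Nat.add_comm N d,
    Finset.sum_range_add]
  have h1 : ∑ j ∈ Finset.range N, (ext x (d + j + 1) - ext y (d + j + 1)) ^ 2 = 0 :=
    Finset.sum_eq_zero fun j _ => by simp [ext]
  rw [h1, Finset.sum_range]
  simp [ext]

theorem norm_chainGrad_sub_le {d T : ℕ} (x y : Vec d) :
    ‖chainGrad (firstWeights T) x - chainGrad (firstWeights T) y‖ ≤ 18 * ‖x - y‖ := by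
  refine abs_le_of_sq_le_sq' ?_ (by positivity) |>.2
  rw [EuclideanSpace.norm_sq_eq, mul_pow]
  -- Cauchy–Schwarz with `1² + 10² + 1² = 102`; the three shifted sums then give `306 ≤ 18²`.
  have h : ∀ j : Fin d, ‖(chainGrad (firstWeights T) x - chainGrad (firstWeights T) y) j‖ ^ 2 ≤
      102 * ((ext x j - ext y j) ^ 2 + (ext x (j + 1) - ext y (j + 1)) ^ 2 +
        (ext x (j + 2) - ext y (j + 2)) ^ 2) := fun j => by
    rw [Real.norm_eq_abs, PiLp.sub_apply]
    have := pow_le_pow_left₀ (abs_nonneg _) (abs_chainGrad_sub_le (T := T) x y j) 2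
    refine this.trans ?_
    rw [← sq_abs (ext x j - ext y j), ← sq_abs (ext x (j + 1) - ext y (j + 1)),
      ← sq_abs (ext x (j + 2) - ext y (j + 2))]
    generalize |ext x j - ext y j| = a
    generalize |ext x (j + 1) - ext y (j + 1)| = b
    generalize |ext x (j + 2) - ext y (j + 2)| = c
    nlinarith [sq_nonneg (10 * a - b), sq_nonneg (a - c), sq_nonneg (10 * c - b)]
  refine (Finset.sum_le_sum fun j _ => h j).trans ?_
  rw [← Finset.mul_sum, Finset.sum_add_distrib, Finset.sum_add_distrib]
  have s0 := sum_ext_sub_sq_le x y d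
  have s1 := sum_ext_sub_sq_le x y (d + 1)
  have s2 := sum_ext_sub_sq_le x y (d + 2)
  rw [Finset.sum_range] at s0
  rw [Finset.sum_range_succ', Finset.sum_range] at s1
  rw [Finset.sum_range_succ', Finset.sum_range_succ', Finset.sum_range] at s2
  have := sq_nonneg (ext x 0 - ext y 0)
  have := sq_nonneg (ext x (0 + 1) - ext y (0 + 1))
  have := sq_nonneg ‖x - y‖
  simp only [add_assoc, Nat.reduceAdd] at s0 s1 s2 ⊢
  nlinarith

/-- As long as the last coordinate of the chain is not discovered, the gradient is large. -/
theorem quarter_le_norm_chainGrad {d T : ℕ} (hT : 0 < T) (hTd : T ≤ d) (x : Vec d)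
    (hx : ext x T = 0) : 1 / 4 ≤ ‖chainGrad (firstWeights T) x‖ := by
  classical
  -- The relevant entry is at the first coordinate below `1`: its predecessor is at least `1`,
  -- possibly as the virtual coordinate, so its gate is half open.
  have hex : ∃ j, ext x (j + 1) < 1 := ⟨T - 1, by
    rw [Nat.sub_add_cancel hT, hx]
    norm_num⟩
  set j := Nat.find hex with hj
  have hj1 : ext x (j + 1) < 1 := Nat.find_spec hex
  have hjT : j < T := by
    have : j ≤ T - 1 := Nat.find_min' hex (by
      rw [Nat.sub_add_cancel hT, hx]
      norm_num)
    omega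
  have hj0 : 1 ≤ ext x j := by
    rcases Nat.eq_zero_or_pos j with h | h
    · rw [h]
      exact le_rfl
    · have := Nat.find_min hex (m := j - 1) (by omega)
      rw [Nat.sub_add_cancel h] at this
      exact not_lt.1 this
  have hle := PiLp.norm_apply_le (chainGrad (firstWeights T) x) ⟨j, hjT.trans_le hTd⟩
  refine le_trans ?_ hle
  rw [Real.norm_eq_abs, chainGrad_apply]
  simp only
  have hw : firstWeights T j = 1 := by simp [firstWeights, hjT]
  have hw' : 0 ≤ firstWeights T (j + 1) := by
    unfold firstWeights
    split_ifs <;> norm_num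
  have h3 : 0 ≤ firstWeights T (j + 1) * (gateDeriv (ext x (j + 1)) * ramp (ext x (j + 2))) :=
    mul_nonneg hw' (mul_nonneg (gateDeriv_nonneg _) (ramp_nonneg _))
  have h2 : 0 ≤ gate (ext x j) * rampDeriv (ext x (j + 1)) :=
    mul_nonneg (gate_nonneg _) (rampDeriv_nonneg _)
  have h1 : 0 ≤ max (-ext x (j + 1)) 0 := le_max_right _ _
  rw [hw, one_mul]
  refine le_trans ?_ (neg_le_abs _)
  -- All terms of this entry have the same sign. On `[-1, 1)` the ramp contributes `1/2 * 1/2`;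
  -- below `-1` the quadratic penalty contributes at least `1`.
  rcases le_or_gt (-1) (ext x (j + 1)) with h | h
  · have := mul_le_mul (half_le_gate hj0) (half_le_rampDeriv (abs_le.2 ⟨h, hj1.le⟩))
      (by norm_num) (gate_nonneg _)
    linarith
  · have := le_max_left (-ext x (j + 1)) 0
    linarith

/-- The chain with gradients of magnitude `a` on the length scale `lam`. -/
def scaledChain {d : ℕ} (a lam : ℝ) (w : ℕ → ℝ) (x : Vec d) : ℝ :=
  a * lam * chain w (lam⁻¹ • x)

lemma hasGradientAt_scaledChain {d : ℕ} {w : ℕ → ℝ} (hw : w d = 0) (a : ℝ) {lam : ℝ}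
    (hlam : lam ≠ 0) (x : Vec d) :
    HasGradientAt (scaledChain a lam w) (a • chainGrad w (lam⁻¹ • x)) x := by
  rw [hasGradientAt_iff_hasFDerivAt]
  have h1 := hasGradientAt_iff_hasFDerivAt.1 (hasGradientAt_chain hw (lam⁻¹ • x))
  have h2 : HasFDerivAt (fun y : Vec d => lam⁻¹ • y)
      (lam⁻¹ • ContinuousLinearMap.id ℝ (Vec d)) x := (hasFDerivAt_id x).const_smul lam⁻¹
  refine ((h1.comp x h2).const_mul (a * lam)).congr_fderiv ?_
  ext z
  simp only [smul_apply, ContinuousLinearMap.comp_apply, InnerProductSpace.toDual_apply_apply,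
    ContinuousLinearMap.id_apply, inner_smul_left, inner_smul_right, smul_eq_mul]
  simp
  field_simp

/-! ### Discovered coordinates -/

/-- The number of leading coordinates outside of which `x` vanishes. -/
def prog {d : ℕ} (x : Vec d) : ℕ := Finset.univ.sup fun j : Fin d => if x j = 0 then 0 else j + 1

lemma prog_le_iff {d : ℕ} {x : Vec d} {N : ℕ} : prog x ≤ N ↔ ∀ j : Fin d, N ≤ j → x j = 0 := by
  simp only [prog, Finset.sup_le_iff, Finset.mem_univ, true_imp_iff]
  refine forall_congr' fun j => ?_
  split_ifs with h
  · simp [h]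
  · simp [h]

lemma ext_eq_zero_of_prog_lt {d : ℕ} {x : Vec d} {j : ℕ} (h : prog x < j) : ext x j = 0 := by
  obtain ⟨j, rfl⟩ := Nat.exists_eq_succ_of_ne_zero (by omega : j ≠ 0)
  simp only [ext]
  split_ifs with hj
  · exact prog_le_iff.1 le_rfl ⟨j, hj⟩ (by simpa using Nat.lt_succ_iff.1 h)
  · rfl

lemma prog_zero {d : ℕ} : prog (0 : Vec d) = 0 :=
  Nat.le_zero.1 (prog_le_iff.2 fun _ _ => rfl)

lemma prog_smul_le {d : ℕ} (r : ℝ) (x : Vec d) : prog (r • x) ≤ prog x :=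
  prog_le_iff.2 fun j hj => by simp [prog_le_iff.1 le_rfl j hj]

lemma chainGrad_eq_zero_of_prog_lt {d : ℕ} (w : ℕ → ℝ) {x : Vec d} {j : Fin d} (h : prog x < j) :
    chainGrad w x j = 0 := by
  rw [chainGrad_apply, ext_eq_zero_of_prog_lt h, ext_eq_zero_of_prog_lt (h.trans (Nat.lt_succ_self _)),
    gate_zero, gateDeriv_zero]
  simp

/-- At the first undiscovered coordinate only the gate-times-ramp term of link `j` survives. This is
the coordinate hidden by a coin, so its size governs the variance. -/
lemma abs_chainGrad_le_of_prog_le {d : ℕ} {w : ℕ → ℝ} {x : Vec d} {j : Fin d} (hw : 0 ≤ w j)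
    (h : prog x ≤ j) : |chainGrad w x j| ≤ w j := by
  rw [chainGrad_apply, ext_eq_zero_of_prog_lt (Nat.lt_succ_iff.2 h), gateDeriv_zero]
  have h1 := gate_le_one (ext x j)
  have h2 := gate_nonneg (ext x j)
  have h3 := rampDeriv_le_one 0
  have h4 := rampDeriv_nonneg 0
  simp only [neg_zero, max_self, sub_zero, zero_mul, mul_zero]
  rw [abs_mul, abs_of_nonneg hw, abs_neg, abs_of_nonneg (mul_nonneg h2 h4)]
  exact mul_le_of_le_one_right hw (mul_le_one₀ h1 h4 h3)

/-! ### The work function -/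

lemma work_mono (v : ℝ → ℝ) : Monotone (work v) := fun _ _ h =>
  MeasureTheory.lintegral_mono_set fun _ hτ => ⟨hτ.1, hτ.2.trans h⟩

lemma work_zero (v : ℝ → ℝ) : work v 0 = 0 := by
  have : {τ : ℝ | 0 ≤ τ ∧ ENNReal.ofReal τ ≤ 0} = {0} := by
    ext τ
    simp only [Set.mem_ofPred_eq, nonpos_iff_eq_zero, ENNReal.ofReal_eq_zero, Set.mem_singleton_iff]
    exact ⟨fun h => le_antisymm h.2 h.1, fun h => ⟨h.ge, h.le⟩⟩
  rw [work, this]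
  simp

lemma work_ne_top {v : ℝ → ℝ} (hv : IsComputationPower v) {t : ℝ≥0∞} (ht : t ≠ ⊤) :
    work v t ≠ ⊤ := by
  have hsub : {τ : ℝ | 0 ≤ τ ∧ ENNReal.ofReal τ ≤ t} ⊆ Set.Icc 0 t.toReal := fun τ hτ =>
    ⟨hτ.1, (ENNReal.ofReal_le_iff_le_toReal ht).1 hτ.2⟩
  exact ((MeasureTheory.lintegral_mono_set hsub).trans_lt
    (hv.integrableOn t.toReal).lintegral_lt_top).ne

/-! ### Bookkeeping for the protocol -/

section Protocol

variable {n d : ℕ} {Ξ : Type} (v : Fin n → ℝ → ℝ) (g : Fin n → Vec d → Ξ → ℝ≥0 → Vec d)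
  (A : Algorithm n d) (ξ : ℕ → Ξ)

/-- The worker called in iteration `k`. -/
def callee (k : ℕ) : Fin n := (A k (run v g A ξ k).2).worker

/-- The state of the called worker before iteration `k`. -/
def calleeState (k : ℕ) : OracleState d := (run v g A ξ k).1 (callee v g A ξ k)

/-- The call in iteration `k` returns a stochastic gradient. -/
def Completes (k : ℕ) : Prop :=
  (A k (run v g A ξ k).2).control = false ∧ (calleeState v g A ξ k).busy = true ∧
    1 ≤ work (v (callee v g A ξ k)) (time v g A ξ (k + 1)) -
      work (v (callee v g A ξ k)) (calleeState v g A ξ k).time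

/-- The outcome of the oracle call in iteration `k`. -/
def outcome (k : ℕ) : OracleState d × Vec d :=
  oracle (v (callee v g A ξ k)) (g (callee v g A ξ k)) (time v g A ξ (k + 1))
    (iterate v g A ξ k) (calleeState v g A ξ k) (A k (run v g A ξ k).2).control (ξ k)

lemma run_succ_fst (k : ℕ) : (run v g A ξ (k + 1)).1 =
    Function.update (run v g A ξ k).1 (callee v g A ξ k) (outcome v g A ξ k).1 := rfl

lemma run_succ_snd (k : ℕ) : (run v g A ξ (k + 1)).2 =
    Fin.snoc (run v g A ξ k).2 (outcome v g A ξ k).2 := rfl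

lemma outcome_of_completes {k : ℕ} (h : Completes v g A ξ k) :
    outcome v g A ξ k = (OracleState.idle d, g (callee v g A ξ k) (calleeState v g A ξ k).point
      (ξ k) (time v g A ξ (k + 1))) := by
  obtain ⟨h1, h2, h3⟩ := h
  simp [outcome, oracle, h1, h2, not_lt.2 h3]

/-- The three ways in which a call may fail to return a stochastic gradient. -/
lemma outcome_of_not_completes {k : ℕ} (h : ¬ Completes v g A ξ k) :
    outcome v g A ξ k = (OracleState.idle d, 0) ∨
    ((calleeState v g A ξ k).busy = false ∧
      outcome v g A ξ k = (⟨time v g A ξ (k + 1), iterate v g A ξ k, true⟩, 0)) ∨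
    outcome v g A ξ k = (calleeState v g A ξ k, 0) := by
  unfold outcome oracle
  split_ifs with h1 h2 h3
  · exact Or.inl rfl
  · exact Or.inr (Or.inl ⟨h2, rfl⟩)
  · exact Or.inr (Or.inr rfl)
  · exact absurd ⟨by simpa using h1, by simpa using h2, not_lt.1 h3⟩ h

variable {A} in
lemma time_mono (hA : IsZeroRespecting A) : Monotone (time v g A ξ) := by
  refine monotone_nat_of_le_succ fun k => ?_
  cases k with
  | zero => exact zero_le
  | succ k =>
    have := hA.time_mono k (run v g A ξ (k + 1)).2
    have e : (fun j : Fin k => (run v g A ξ (k + 1)).2 j.castSucc) = (run v g A ξ k).2 :=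
      funext fun j => by rw [run_succ_snd, Fin.snoc_castSucc]
    rw [e] at this
    exact this

/-- The number of coordinates discovered before iteration `k`. -/
def discovered (k : ℕ) : ℕ := Finset.univ.sup fun j : Fin k => prog ((run v g A ξ k).2 j)

lemma discovered_zero : discovered v g A ξ 0 = 0 := rfl

lemma discovered_succ (k : ℕ) : discovered v g A ξ (k + 1) =
    max (discovered v g A ξ k) (prog (outcome v g A ξ k).2) := by
  refine eq_of_forall_ge_iff fun N => ?_
  simp only [discovered, Finset.sup_le_iff, Finset.mem_univ, true_imp_iff, max_le_iff,
    run_succ_snd, Fin.forall_fin_succ', Fin.snoc_castSucc, Fin.snoc_last]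

variable {A} in
lemma prog_iterate_le (hA : IsZeroRespecting A) (k : ℕ) :
    prog (iterate v g A ξ k) ≤ discovered v g A ξ k := by
  refine prog_le_iff.2 fun l hl => ?_
  by_contra h
  obtain ⟨j, hj⟩ := hA.supp_subset k _ l h
  refine hj (prog_le_iff.1 le_rfl l (le_trans ?_ hl))
  exact Finset.le_sup (f := fun j : Fin k => prog ((run v g A ξ k).2 j)) (Finset.mem_univ j)

variable {A} in
lemma prog_state_le (hA : IsZeroRespecting A) (k : ℕ) (i : Fin n) :
    prog ((run v g A ξ k).1 i).point ≤ discovered v g A ξ k := by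
  induction k generalizing i with
  | zero => exact prog_zero.le
  | succ k ih =>
    have hm : discovered v g A ξ k ≤ discovered v g A ξ (k + 1) := by
      rw [discovered_succ]
      exact le_max_left _ _
    refine le_trans ?_ hm
    rw [run_succ_fst]
    by_cases hi : i = callee v g A ξ k
    · subst hi
      rw [Function.update_self]
      have h0 : prog (OracleState.idle d).point ≤ discovered v g A ξ k := by
        simp [OracleState.idle, prog_zero]
      by_cases hc : Completes v g A ξ k
      · rw [outcome_of_completes v g A ξ hc]
        exact h0
      · rcases outcome_of_not_completes v g A ξ hc with h | ⟨-, h⟩ | h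
        · rw [h]
          exact h0
        · rw [h]
          exact prog_iterate_le v g ξ hA k
        · rw [h]
          exact ih _
    · rw [Function.update_of_ne hi]
      exact ih i

/-- A stochastic gradient at a point with `N` discovered coordinates discovers at most one more,
and none unless the coin of the worker for the block of that coordinate shows heads. -/
def GatedBy (coin : Fin n → ℕ → Ξ → Bool) (m : ℕ) : Prop :=
  ∀ (i : Fin n) (x : Vec d) (y : Ξ) (t : ℝ≥0) (N : ℕ), prog x ≤ N →
    prog (g i x y t) ≤ N + 1 ∧ (coin i (N / m) y = false → prog (g i x y t) ≤ N)

variable {A g} in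
lemma discovered_succ_le_of_not_completes {k : ℕ} (h : ¬ Completes v g A ξ k) :
    discovered v g A ξ (k + 1) ≤ discovered v g A ξ k := by
  rw [discovered_succ]
  refine max_le le_rfl ?_
  rcases outcome_of_not_completes v g A ξ h with h | ⟨-, h⟩ | h <;> rw [h] <;>
    exact prog_zero.le.trans (Nat.zero_le _)

variable {A g} in
lemma discovered_succ_le (hA : IsZeroRespecting A) {coin : Fin n → ℕ → Ξ → Bool} {m : ℕ}
    (hg : GatedBy g coin m) (k : ℕ) :
    discovered v g A ξ (k + 1) ≤ discovered v g A ξ k + 1 := by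
  by_cases hc : Completes v g A ξ k
  · rw [discovered_succ, outcome_of_completes v g A ξ hc]
    exact max_le (Nat.le_succ _) (hg _ _ _ _ _ (prog_state_le v g ξ hA k _)).1
  · exact (discovered_succ_le_of_not_completes v ξ hc).trans (Nat.le_succ _)

-- A worker may hold an outdated point with fewer coordinates than are known by now. `GatedBy`
-- allows every `N ≥ prog x`, so it applies with the current number of discovered coordinates.
variable {A g} in
lemma discovered_succ_le_of_coin (hA : IsZeroRespecting A) {coin : Fin n → ℕ → Ξ → Bool} {m : ℕ}
    (hg : GatedBy g coin m) {k : ℕ}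
    (h : coin (callee v g A ξ k) (discovered v g A ξ k / m) (ξ k) = false) :
    discovered v g A ξ (k + 1) ≤ discovered v g A ξ k := by
  by_cases hc : Completes v g A ξ k
  · rw [discovered_succ, outcome_of_completes v g A ξ hc]
    exact max_le le_rfl ((hg _ _ _ _ _ (prog_state_le v g ξ hA k _)).2 h)
  · exact discovered_succ_le_of_not_completes v ξ hc

/-- The call in iteration `k` returns a stochastic gradient in the time window `(s, u]`. -/
def CompletesIn (s u : ℝ≥0∞) (k : ℕ) : Prop :=
  Completes v g A ξ k ∧ s < time v g A ξ (k + 1) ∧ (time v g A ξ (k + 1) : ℝ≥0∞) ≤ u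

open Classical in
/-- The number of stochastic gradients of worker `i` in the window `(s, u]`. -/
def callCount (s u : ℝ≥0∞) (i : Fin n) (k : ℕ) : ℕ :=
  ∑ j ∈ Finset.range k, if CompletesIn v g A ξ s u j ∧ callee v g A ξ j = i then 1 else 0

open Classical in
/-- The number of stochastic gradients in the window `(s, u]` whose coin shows heads. -/
def headCount (coin : Fin n → Ξ → Bool) (s u : ℝ≥0∞) (k : ℕ) : ℕ :=
  ∑ j ∈ Finset.range k,
    if CompletesIn v g A ξ s u j ∧ coin (callee v g A ξ j) (ξ j) = true then 1 else 0

/-- The time from which worker `i` can be working on its next stochastic gradient. -/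
def refTime (i : Fin n) (k : ℕ) : ℝ≥0 :=
  if ((run v g A ξ k).1 i).busy = true then ((run v g A ξ k).1 i).time else time v g A ξ k

variable {A} in
lemma refTime_le_time (hA : IsZeroRespecting A) (i : Fin n) (k : ℕ) :
    refTime v g A ξ i k ≤ time v g A ξ k := by
  induction k with
  | zero => simp [refTime, run, OracleState.idle]
  | succ k ih =>
    have hm := time_mono v g ξ hA (Nat.le_succ k)
    unfold refTime at ih ⊢
    rw [run_succ_fst]
    by_cases hi : i = callee v g A ξ k
    · subst hi
      rw [Function.update_self]
      by_cases hc : Completes v g A ξ k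
      · rw [outcome_of_completes v g A ξ hc]
        simp [OracleState.idle]
      · rcases outcome_of_not_completes v g A ξ hc with h | ⟨-, h⟩ | h
        · simp [h, OracleState.idle]
        · simp [h]
        · rw [h]
          change (if (calleeState v g A ξ k).busy = true then _ else _) ≤ _ at ih
          split_ifs at ih ⊢ with hb
          · exact ih.trans hm
          · exact le_rfl
    · rw [Function.update_of_ne hi]
      split_ifs at ih ⊢ with hb
      · exact ih.trans hm
      · exact le_rfl

variable {A} in
lemma refTime_le_succ (hA : IsZeroRespecting A) (i : Fin n) (k : ℕ) :
    refTime v g A ξ i k ≤ refTime v g A ξ i (k + 1) := by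
  have hm := time_mono v g ξ hA (Nat.le_succ k)
  have hr := refTime_le_time v g ξ hA i k
  have hidle : refTime v g A ξ i k ≤ time v g A ξ (k + 1) := hr.trans hm
  rw [refTime.eq_1 v g A ξ i (k + 1), run_succ_fst]
  by_cases hi : i = callee v g A ξ k
  · subst hi
    rw [Function.update_self]
    by_cases hc : Completes v g A ξ k
    · rw [outcome_of_completes v g A ξ hc]
      simpa [OracleState.idle] using hidle
    · rcases outcome_of_not_completes v g A ξ hc with h | ⟨-, h⟩ | h
      · simpa [h, OracleState.idle] using hidle
      · simpa [h] using hidle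
      · rw [h]
        change _ ≤ if (calleeState v g A ξ k).busy = true then _ else _
        split_ifs with hb
        · unfold refTime
          exact (if_pos hb).le
        · exact hidle
  · rw [Function.update_of_ne hi]
    split_ifs with hb
    · unfold refTime
      rw [if_pos hb]
    · exact hidle

lemma refTime_of_completes {k : ℕ} (hc : Completes v g A ξ k) :
    refTime v g A ξ (callee v g A ξ k) k = (calleeState v g A ξ k).time ∧
      refTime v g A ξ (callee v g A ξ k) (k + 1) = time v g A ξ (k + 1) := by
  constructor
  · unfold refTime
    exact if_pos hc.2.1
  · unfold refTime
    rw [run_succ_fst, Function.update_self, outcome_of_completes v g A ξ hc]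
    simp [OracleState.idle]

variable {v A} in
/-- A worker returns at most one stochastic gradient more than the work it can do in a window. -/
theorem callCount_le (hv : ∀ i, IsComputationPower (v i)) (hA : IsZeroRespecting A)
    (s u : ℝ≥0∞) (i : Fin n) (k : ℕ) :
    (callCount v g A ξ s u i k : ℝ≥0∞) ≤ 1 + (work (v i) u - work (v i) s) := by
  -- From the first completion on, the count is charged to the work done up to the reference time.
  -- The extra `1` pays for a computation begun before `s`. The bound by the work up to `u` is kept
  -- separately, as the reference time may move past `u`. The additive form avoids truncated
  -- subtraction.
  suffices H : callCount v g A ξ s u i k = 0 ∨ (s ≤ refTime v g A ξ i k ∧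
      (callCount v g A ξ s u i k : ℝ≥0∞) + work (v i) s ≤
        1 + work (v i) (refTime v g A ξ i k) ∧
      (callCount v g A ξ s u i k : ℝ≥0∞) + work (v i) s ≤ 1 + work (v i) u) by
    rcases H with H | ⟨h1, -, h3⟩
    · rw [H]
      simp
    · have hs : work (v i) s ≠ ⊤ := work_ne_top (hv i) (h1.trans_lt ENNReal.coe_lt_top).ne
      exact (ENNReal.le_sub_of_add_le_right hs h3).trans add_tsub_le_assoc
  induction k with
  | zero => exact Or.inl rfl
  | succ k ih =>
    have hr := refTime_le_succ v g ξ hA i k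
    have hr' : (refTime v g A ξ i k : ℝ≥0∞) ≤ refTime v g A ξ i (k + 1) := by exact_mod_cast hr
    by_cases h : CompletesIn v g A ξ s u k ∧ callee v g A ξ k = i
    · have e : callCount v g A ξ s u i (k + 1) = callCount v g A ξ s u i k + 1 := by
        unfold callCount
        rw [Finset.sum_range_succ, if_pos h]
      obtain ⟨⟨hc, hs, hu⟩, rfl⟩ := h
      obtain ⟨r1, r2⟩ := refTime_of_completes v g A ξ hc
      rw [e, r2]
      rw [r1] at ih
      have key : ((callCount v g A ξ s u (callee v g A ξ k) k + 1 : ℕ) : ℝ≥0∞) +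
          work (v (callee v g A ξ k)) s ≤
            1 + work (v (callee v g A ξ k)) (time v g A ξ (k + 1)) := by
        rcases ih with h0 | ⟨-, h2, -⟩
        · rw [h0]
          simpa using work_mono _ hs.le
        · have hst : work (v (callee v g A ξ k)) (calleeState v g A ξ k).time + 1 ≤
              work (v (callee v g A ξ k)) (time v g A ξ (k + 1)) := by
            have hne := work_ne_top (hv (callee v g A ξ k))
              (ENNReal.coe_ne_top (r := (calleeState v g A ξ k).time))
            rw [add_comm]
            refine ((ENNReal.cancel_of_ne hne).le_tsub_iff_right ?_).1 hc.2.2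
            by_contra hcon
            have := hc.2.2
            rw [tsub_eq_zero_of_le (not_le.1 hcon).le] at this
            exact absurd this (by norm_num)
          push_cast
          calc _ = 1 + ((callCount v g A ξ s u (callee v g A ξ k) k : ℝ≥0∞) +
                work (v (callee v g A ξ k)) s) := by ring
            _ ≤ 1 + (1 + work (v (callee v g A ξ k)) (calleeState v g A ξ k).time) := by gcongr
            _ ≤ _ := by
              rw [add_comm 1 (work _ _)]
              gcongr
      exact Or.inr ⟨hs.le, key, key.trans (by gcongr; exact work_mono _ hu)⟩
    · have e : callCount v g A ξ s u i (k + 1) = callCount v g A ξ s u i k := by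
        unfold callCount
        rw [Finset.sum_range_succ, if_neg h, add_zero]
      rw [e]
      rcases ih with h0 | ⟨h1, h2, h3⟩
      · exact Or.inl h0
      · exact Or.inr ⟨h1.trans hr', h2.trans (by gcongr; exact work_mono _ hr'), h3⟩

-- A stochastic gradient costs one unit of work, and no work is done by time `0`. This starts the
-- induction over windows.
variable {g A} in
lemma discovered_eq_zero_of_time_eq_zero (hA : IsZeroRespecting A) (k : ℕ)
    (h : time v g A ξ k = 0) : discovered v g A ξ k = 0 := by
  induction k with
  | zero => rfl
  | succ k ih =>
    have h0 : time v g A ξ k = 0 :=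
      le_antisymm ((time_mono v g ξ hA (Nat.le_succ k)).trans h.le) zero_le
    have hc : ¬ Completes v g A ξ k := fun hc => by
      have := hc.2.2
      rw [h, ENNReal.coe_zero, work_zero, zero_tsub] at this
      exact absurd this (by norm_num)
    exact Nat.le_zero.1 ((discovered_succ_le_of_not_completes v ξ hc).trans (ih h0).le)

variable {g A} in
/-- If in no window the coins of the corresponding block show `m` heads, then the discovery of
coordinates is not faster than one block per window. -/
theorem discovered_le (hA : IsZeroRespecting A) {coin : Fin n → ℕ → Ξ → Bool} {m : ℕ}
    (hg : GatedBy g coin m) {T : ℕ → ℝ≥0∞} (hT : T 0 = 0) {K : ℕ}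
    (hS : ∀ b < K, ∀ k, headCount v g A ξ (fun i => coin i b) (T b) (T (b + 1)) k < m) :
    ∀ b ≤ K, ∀ k, (time v g A ξ k : ℝ≥0∞) ≤ T b → discovered v g A ξ k ≤ b * m := by
  intro b
  induction b with
  | zero =>
    intro _ k hk
    rw [hT, nonpos_iff_eq_zero, ENNReal.coe_eq_zero] at hk
    rw [discovered_eq_zero_of_time_eq_zero v ξ hA k hk]
    exact Nat.zero_le _
  | succ b ihb =>
    intro hbK
    have hb := hS b (by omega)
    have ihb := ihb (by omega)
    have key : ∀ k, (time v g A ξ k : ℝ≥0∞) ≤ T (b + 1) → discovered v g A ξ k ≤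
        b * m + headCount v g A ξ (fun i => coin i b) (T b) (T (b + 1)) k := by
      intro k
      induction k with
      | zero =>
        intro _
        rw [discovered_zero]
        exact Nat.zero_le _
      | succ k ihk =>
        intro hk
        have htm : (time v g A ξ k : ℝ≥0∞) ≤ time v g A ξ (k + 1) := by
          exact_mod_cast time_mono v g ξ hA (Nat.le_succ k)
        have ihk := ihk (htm.trans hk)
        have hcnt : headCount v g A ξ (fun i => coin i b) (T b) (T (b + 1)) k ≤
            headCount v g A ξ (fun i => coin i b) (T b) (T (b + 1)) (k + 1) := by
          unfold headCount
          rw [Finset.sum_range_succ]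
          exact Nat.le_add_right _ _
        rcases le_or_gt (time v g A ξ (k + 1) : ℝ≥0∞) (T b) with ht | ht
        · exact (ihb (k + 1) ht).trans (Nat.le_add_right _ _)
        have h1 := discovered_succ_le v ξ hA hg k
        -- Before block `b` is reached, a single discovery cannot exceed `b * m`, whatever the coin
        -- shows.
        rcases lt_or_ge (discovered v g A ξ k) (b * m) with hd | hd
        · omega
        -- Fewer than `m` heads so far keep the discovery inside block `b`, so the coin of block `b`
        -- is the one that decides.
        have hdiv : discovered v g A ξ k / m = b := by
          have := hb k
          refine Nat.div_eq_of_lt_le hd ?_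
          rw [add_mul]
          omega
        by_cases hc : Completes v g A ξ k
        · by_cases hcoin : coin (callee v g A ξ k) b (ξ k) = true
          · have : headCount v g A ξ (fun i => coin i b) (T b) (T (b + 1)) (k + 1) =
                headCount v g A ξ (fun i => coin i b) (T b) (T (b + 1)) k + 1 := by
              unfold headCount
              rw [Finset.sum_range_succ, if_pos ⟨⟨hc, ht, hk⟩, hcoin⟩]
            omega
          · have := discovered_succ_le_of_coin v ξ hA hg (k := k) (by
              rw [hdiv]
              simpa using hcoin)
            omega
        · have := discovered_succ_le_of_not_completes v ξ hc
          omega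
    intro k hk
    have h1 := key k hk
    have h2 := hb k
    rw [add_mul]
    omega

end Protocol

/-! ### Independent draws -/

section Draws

open MeasureTheory ProbabilityTheory

variable {Ξ : Type}

/-- `F` is determined by the first `k` draws. -/
def Local {β : Type*} (k : ℕ) (F : (ℕ → Ξ) → β) : Prop :=
  ∀ ξ ξ' : ℕ → Ξ, (∀ j < k, ξ j = ξ' j) → F ξ = F ξ'

lemma Local.exists_factor {β : Type*} {k : ℕ} {F : (ℕ → Ξ) → β} (hF : Local k F) [Nonempty Ξ] :
    ∃ G : (Fin k → Ξ) → β, ∀ ξ, F ξ = G fun j => ξ j :=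
  ⟨fun y => F fun j => if h : j < k then y ⟨j, h⟩ else Classical.arbitrary Ξ,
    fun ξ => hF _ _ fun j hj => by simp [hj]⟩

variable [MeasurableSpace Ξ]

lemma Local.measurable [Finite Ξ] [MeasurableSingletonClass Ξ] {β : Type*} [MeasurableSpace β]
    {k : ℕ} {F : (ℕ → Ξ) → β} (hF : Local k F) : Measurable F := by
  rcases isEmpty_or_nonempty Ξ with h | h
  · have : IsEmpty (ℕ → Ξ) := ⟨fun ξ => h.false (ξ 0)⟩
    exact measurable_of_empty F
  · obtain ⟨G, hG⟩ := hF.exists_factor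
    rw [funext hG]
    exact (measurable_of_finite G).comp (by fun_prop)

variable (D : Measure Ξ) [IsProbabilityMeasure D]

/-- The law of the sequence of draws. -/
abbrev draws : Measure (ℕ → Ξ) := Measure.infinitePi fun _ : ℕ => D

lemma indepFun_past_present (k : ℕ) :
    IndepFun (fun (ξ : ℕ → Ξ) (j : Fin k) => ξ j) (fun ξ => ξ k) (draws D) := by
  have h : iIndepFun (fun (j : ℕ) (ξ : ℕ → Ξ) => ξ j) (draws D) :=
    iIndepFun_infinitePi (X := fun _ (y : Ξ) => y) fun _ => measurable_id
  have h2 := h.indepFun_finset (Finset.range k) {k} (by simp) fun j => measurable_pi_apply j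
  have hψ : Measurable fun y : ({k} : Finset ℕ) → Ξ => y ⟨k, Finset.mem_singleton_self k⟩ :=
    measurable_pi_apply _
  exact h2.comp (φ := fun y (j : Fin k) => y ⟨j, Finset.mem_range.2 j.2⟩) (by fun_prop) hψ

variable [Finite Ξ] [MeasurableSingletonClass Ξ]

/-- Integrating out the present draw. -/
lemma lintegral_local (k : ℕ) (R : (ℕ → Ξ) → Ξ → ℝ≥0∞) (hR : Local k R) :
    ∫⁻ ξ, R ξ (ξ k) ∂draws D = ∫⁻ ξ, ∫⁻ y, R ξ y ∂D ∂draws D := by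
  have : Nonempty Ξ := nonempty_of_isProbabilityMeasure D
  obtain ⟨G, hG⟩ := hR.exists_factor
  have hm : Measurable fun (ξ : ℕ → Ξ) (j : Fin k) => ξ j := by fun_prop
  have hk : Measurable fun ξ : ℕ → Ξ => ξ k := by fun_prop
  have hprod := (indepFun_iff_map_prod_eq_prod_map_map hm.aemeasurable hk.aemeasurable).1
    (indepFun_past_present D k)
  have hD : (draws D).map (fun ξ : ℕ → Ξ => ξ k) = D := Measure.infinitePi_map_eval _ k
  rw [hD] at hprod
  simp only [hG]
  have hGm : Measurable (Function.uncurry G) := measurable_of_finite _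
  calc _ = ∫⁻ z, Function.uncurry G z
        ∂((draws D).map fun ξ : ℕ → Ξ => ((fun j : Fin k => ξ j), ξ k)) :=
        (lintegral_map hGm (hm.prodMk hk)).symm
    _ = ∫⁻ x, ∫⁻ y, G x y ∂D ∂((draws D).map fun (ξ : ℕ → Ξ) (j : Fin k) => ξ j) := by
        rw [hprod, lintegral_prod _ hGm.aemeasurable]
        rfl
    _ = _ := lintegral_map (measurable_of_finite _) hm

/-- A product of adaptively chosen factors of mean one has mean one. -/
lemma lintegral_prod_local (R : ℕ → (ℕ → Ξ) → Ξ → ℝ≥0∞) (hR : ∀ k, Local k (R k))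
    (hR1 : ∀ k ξ, ∫⁻ y, R k ξ y ∂D = 1) (k : ℕ) :
    ∫⁻ ξ, ∏ j ∈ Finset.range k, R j ξ (ξ j) ∂draws D = 1 := by
  induction k with
  | zero => simp
  | succ k ih =>
    -- The earlier factors and the choice of the `k`-th factor depend only on the past, so the draw
    -- `ξ k` can be integrated out alone.
    have hloc : Local k fun (ξ : ℕ → Ξ) (y : Ξ) =>
        (∏ j ∈ Finset.range k, R j ξ (ξ j)) * R k ξ y := fun ξ ξ' h => by
      have : ∏ j ∈ Finset.range k, R j ξ (ξ j) = ∏ j ∈ Finset.range k, R j ξ' (ξ' j) :=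
        Finset.prod_congr rfl fun j hj => by
          have hj := Finset.mem_range.1 hj
          rw [hR j ξ ξ' fun l hl => h l (hl.trans hj), h j hj]
      simp only [this, hR k ξ ξ' h]
    have := lintegral_local D k _ hloc
    simp only [Finset.prod_range_succ]
    rw [this, ← ih]
    refine lintegral_congr fun ξ => ?_
    rw [lintegral_const_mul _ (measurable_of_finite _), hR1, mul_one]

end Draws

section Heads

open MeasureTheory ProbabilityTheory

variable {n d : ℕ} {Ξ : Type} (v : Fin n → ℝ → ℝ) (g : Fin n → Vec d → Ξ → ℝ≥0 → Vec d)
  (A : Algorithm n d)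

lemma local_run (k : ℕ) : Local k fun ξ => run v g A ξ k := by
  induction k with
  | zero => exact fun _ _ _ => rfl
  | succ k ih =>
    intro ξ ξ' h
    have e := ih ξ ξ' fun j hj => h j (hj.trans (Nat.lt_succ_self k))
    simp only at e
    simp only [run, e, h k (Nat.lt_succ_self k)]

lemma local_callee (k : ℕ) : Local k fun ξ => callee v g A ξ k := fun ξ ξ' h => by
  have e := local_run v g A k ξ ξ' h
  simp only at e
  simp only [callee, e]

/-- The whole query of iteration `k`, including its time, is fixed by the earlier draws: whether a
call completes is settled before its coin is tossed. -/
lemma local_completesIn (s u : ℝ≥0∞) (k : ℕ) : Local k fun ξ => CompletesIn v g A ξ s u k :=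
  fun ξ ξ' h => by
  have e := local_run v g A k ξ ξ' h
  simp only at e
  simp only [CompletesIn, Completes, calleeState, callee, time, e]

lemma local_headCount (coin : Fin n → Ξ → Bool) (s u : ℝ≥0∞) (k : ℕ) :
    Local k fun ξ => headCount v g A ξ coin s u k := fun ξ ξ' h => by
  classical
  refine Finset.sum_congr rfl fun j hj => ?_
  have hj := Finset.mem_range.1 hj
  have h' : ∀ l < j, ξ l = ξ' l := fun l hl => h l (hl.trans hj)
  have e1 := local_callee v g A j ξ ξ' h'
  have e2 := local_completesIn v g A s u j ξ ξ' h'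
  simp only at e1 e2
  simp only [e1, e2, h j hj]

lemma headCount_mono (ξ : ℕ → Ξ) (coin : Fin n → Ξ → Bool) (s u : ℝ≥0∞) :
    Monotone (headCount v g A ξ coin s u) := by
  classical
  refine monotone_nat_of_le_succ fun k => ?_
  unfold headCount
  rw [Finset.sum_range_succ]
  exact Nat.le_add_right _ _

open Classical in
/-- The likelihood-type factor of the call in iteration `k`. -/
def headFactor (coin : Fin n → Ξ → Bool) (p : Fin n → ℝ≥0) (s u : ℝ≥0∞) (k : ℕ) (ξ : ℕ → Ξ)
    (y : Ξ) : ℝ≥0∞ :=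
  if CompletesIn v g A ξ s u k then
    (if coin (callee v g A ξ k) y = true then 2 else 1) / (1 + p (callee v g A ξ k)) else 1

lemma local_headFactor (coin : Fin n → Ξ → Bool) (p : Fin n → ℝ≥0) (s u : ℝ≥0∞) (k : ℕ) :
    Local k (headFactor v g A coin p s u k) := fun ξ ξ' h => by
  have e1 := local_callee v g A k ξ ξ' h
  have e2 := local_completesIn v g A s u k ξ ξ' h
  simp only at e1 e2
  funext y
  unfold headFactor
  rw [e1]
  congr 1

lemma lintegral_headFactor [MeasurableSpace Ξ] [Finite Ξ] [MeasurableSingletonClass Ξ]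
    (D : Measure Ξ) [IsProbabilityMeasure D] {coin : Fin n → Ξ → Bool} {p : Fin n → ℝ≥0}
    (hp : ∀ i, D {y | coin i y = true} = p i) (s u : ℝ≥0∞) (k : ℕ) (ξ : ℕ → Ξ) :
    ∫⁻ y, headFactor v g A coin p s u k ξ y ∂D = 1 := by
  unfold headFactor
  split_ifs with h
  · generalize callee v g A ξ k = i
    simp only [div_eq_mul_inv]
    rw [lintegral_mul_const _ (measurable_of_finite _)]
    have e : ∀ y, (if coin i y = true then (2 : ℝ≥0∞) else 1) =
        1 + Set.indicator {y | coin i y = true} 1 y := fun y => by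
      by_cases hy : coin i y = true
      · simp [hy, one_add_one_eq_two]
      · simp [hy]
    simp only [e]
    rw [lintegral_add_left measurable_const, lintegral_indicator_one (Set.toFinite _).measurableSet,
      hp]
    simp only [lintegral_const, measure_univ, mul_one]
    exact ENNReal.mul_inv_cancel (by simp) (by simp)
  · simp

variable {v A} in
/-- The number of heads is controlled by the product of the head factors. -/
lemma two_pow_headCount_le (hv : ∀ i, IsComputationPower (v i)) (hA : IsZeroRespecting A)
    (coin : Fin n → Ξ → Bool) (p : Fin n → ℝ≥0) (s u : ℝ≥0∞) {B : ℝ} (hB0 : 0 ≤ B)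
    (hB : ∑ i, (p i : ℝ≥0∞) * (1 + (work (v i) u - work (v i) s)) ≤ ENNReal.ofReal B)
    (k : ℕ) (ξ : ℕ → Ξ) :
    (2 : ℝ≥0∞) ^ headCount v g A ξ coin s u k ≤
      ENNReal.ofReal (Real.exp B) * ∏ j ∈ Finset.range k, headFactor v g A coin p s u j ξ (ξ j) := by
  classical
  set q : ℕ → ℝ := fun j => if CompletesIn v g A ξ s u j then (p (callee v g A ξ j) : ℝ) else 0
    with hq
  have hq0 : ∀ j, 0 ≤ q j := fun j => by
    simp only [hq]
    split_ifs <;> positivity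
  -- Each completed call contributes `2` or `1`, written as `1 + p` times a factor of mean one; the
  -- remaining product of `1 + p` is then bounded deterministically.
  have e1 : (2 : ℝ≥0∞) ^ headCount v g A ξ coin s u k =
      (∏ j ∈ Finset.range k, ENNReal.ofReal (1 + q j)) *
        ∏ j ∈ Finset.range k, headFactor v g A coin p s u j ξ (ξ j) := by
    unfold headCount
    rw [← Finset.prod_pow_eq_pow_sum, ← Finset.prod_mul_distrib]
    refine Finset.prod_congr rfl fun j _ => ?_
    by_cases hc : CompletesIn v g A ξ s u j
    · have : ENNReal.ofReal (1 + q j) = 1 + p (callee v g A ξ j) := by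
        simp only [hq, hc, if_true]
        rw [ENNReal.ofReal_add zero_le_one NNReal.zero_le_coe, ENNReal.ofReal_one,
          ENNReal.ofReal_coe_nnreal]
      rw [this]
      unfold headFactor
      rw [if_pos hc, ENNReal.mul_div_cancel (by simp) (by simp)]
      by_cases hy : coin (callee v g A ξ j) (ξ j) = true <;> simp [hc, hy]
    · simp [hq, hc, headFactor]
  rw [e1]
  gcongr
  rw [← ENNReal.ofReal_prod_of_nonneg fun j _ => by linarith [hq0 j]]
  refine ENNReal.ofReal_le_ofReal ?_
  have h1 : ∏ j ∈ Finset.range k, (1 + q j) ≤ Real.exp (∑ j ∈ Finset.range k, q j) := by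
    rw [Real.exp_sum]
    refine Finset.prod_le_prod (fun j _ => by linarith [hq0 j]) fun j _ => ?_
    rw [add_comm]
    exact Real.add_one_le_exp (q j)
  refine h1.trans (Real.exp_le_exp.2 ?_)
  -- Grouping the calls by worker brings in the deterministic bound on the number of calls.
  have h2 : ∑ j ∈ Finset.range k, q j = ∑ i, (p i : ℝ) * callCount v g A ξ s u i k := by
    simp only [callCount, Nat.cast_sum, Finset.mul_sum]
    rw [Finset.sum_comm]
    refine Finset.sum_congr rfl fun j _ => ?_
    by_cases hc : CompletesIn v g A ξ s u j <;> simp [hq, hc]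
  rw [h2, ← ENNReal.ofReal_le_ofReal_iff hB0]
  refine le_trans (le_of_eq ?_) (le_trans (Finset.sum_le_sum fun i _ =>
    mul_le_mul_right (callCount_le g ξ hv hA s u i k) (p i : ℝ≥0∞)) hB)
  rw [ENNReal.ofReal_sum_of_nonneg fun i _ => by positivity]
  refine Finset.sum_congr rfl fun i _ => ?_
  rw [ENNReal.ofReal_mul (by positivity), ENNReal.ofReal_coe_nnreal, ENNReal.ofReal_natCast]

variable {v A} in
/-- It is unlikely that the coins show `m` heads in a window in which at most `m / 4` heads are
expected. -/
theorem measure_headCount_ge_le [MeasurableSpace Ξ] [Finite Ξ] [MeasurableSingletonClass Ξ]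
    (hv : ∀ i, IsComputationPower (v i)) (hA : IsZeroRespecting A)
    (D : Measure Ξ) [IsProbabilityMeasure D] {coin : Fin n → Ξ → Bool} {p : Fin n → ℝ≥0}
    (hp : ∀ i, D {y | coin i y = true} = p i) (s u : ℝ≥0∞) (m : ℕ)
    (hB : ∑ i, (p i : ℝ≥0∞) * (1 + (work (v i) u - work (v i) s)) ≤
      ENNReal.ofReal ((m : ℝ) / 4)) :
    draws D {ξ | ∃ k, m ≤ headCount v g A ξ coin s u k} ≤
      ENNReal.ofReal (Real.exp (-((m : ℝ) / 4))) := by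
  have hset : {ξ | ∃ k, m ≤ headCount v g A ξ coin s u k} =
      ⋃ k, {ξ | m ≤ headCount v g A ξ coin s u k} := by
    ext ξ
    simp
  have hmono : Monotone fun k => {ξ | m ≤ headCount v g A ξ coin s u k} :=
    fun k l hkl ξ hξ => le_trans hξ (headCount_mono v g A ξ coin s u hkl)
  -- Continuity from below: a bound uniform in `k` suffices.
  rw [hset, hmono.measure_iUnion]
  refine iSup_le fun k => ?_
  have hint := lintegral_prod_local D (headFactor v g A coin p s u)
    (local_headFactor v g A coin p s u) (lintegral_headFactor v g A D hp s u) k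
  have hmarkov := mul_meas_ge_le_lintegral (μ := draws D)
    (f := fun ξ => (2 : ℝ≥0∞) ^ headCount v g A ξ coin s u k)
    ((measurable_of_countable fun N : ℕ => (2 : ℝ≥0∞) ^ N).comp
      (local_headCount v g A coin s u k).measurable) (2 ^ m)
  have hle : ∫⁻ ξ, (2 : ℝ≥0∞) ^ headCount v g A ξ coin s u k ∂draws D ≤
      ENNReal.ofReal (Real.exp ((m : ℝ) / 4)) := by
    refine (lintegral_mono fun ξ => two_pow_headCount_le g hv hA coin p s u (by positivity)
      hB k ξ).trans ?_
    rw [lintegral_const_mul' _ _ ENNReal.ofReal_ne_top, hint, mul_one]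
  have hsub : {ξ | m ≤ headCount v g A ξ coin s u k} ⊆
      {ξ | (2 : ℝ≥0∞) ^ m ≤ 2 ^ headCount v g A ξ coin s u k} :=
    fun ξ hξ => by
      rw [Set.mem_ofPred_eq] at hξ ⊢
      exact pow_le_pow_right₀ one_le_two hξ
  have h3 : (2 : ℝ≥0∞) ^ m * draws D {ξ | m ≤ headCount v g A ξ coin s u k} ≤
      ENNReal.ofReal (Real.exp ((m : ℝ) / 4)) :=
    (mul_le_mul_right (measure_mono hsub) _).trans (hmarkov.trans hle)
  have h4 : ENNReal.ofReal (Real.exp ((m : ℝ) / 4)) ≤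
      2 ^ m * ENNReal.ofReal (Real.exp (-((m : ℝ) / 4))) := by
    have : (2 : ℝ≥0∞) ^ m = ENNReal.ofReal (2 ^ m) := by
      rw [ENNReal.ofReal_pow zero_le_two]
      simp
    rw [this, ← ENNReal.ofReal_mul (by positivity)]
    refine ENNReal.ofReal_le_ofReal ?_
    -- This is `log 2 ≥ 1/2`; it turns the Markov bound `exp(m/4) / 2^m` into `exp(-m/4)`.
    have h2 : Real.exp ((m : ℝ) / 2) ≤ 2 ^ m := by
      rw [← Real.exp_log (by positivity : (0 : ℝ) < 2 ^ m), Real.exp_le_exp, Real.log_pow]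
      have := Real.log_two_gt_d9
      nlinarith [(Nat.cast_nonneg m : (0 : ℝ) ≤ m)]
    calc Real.exp ((m : ℝ) / 4) = Real.exp ((m : ℝ) / 2) * Real.exp (-((m : ℝ) / 4)) := by
          rw [← Real.exp_add]
          ring_nf
      _ ≤ _ := by gcongr
  exact (ENNReal.mul_le_mul_iff_right (by simp) (by simp)).1 (h3.trans h4)

end Heads

/-! ### The weights of a block -/

section Weights

open MeasureTheory Filter Topology

/-- Left continuity, also at `u = ∞`: the sets exhaust everything up to `u` except one point, which
is null. It is needed because the defining inequality of a window fails only strictly before its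
end. -/
lemma tendsto_work (v : ℝ → ℝ) {u : ℝ≥0∞} {t : ℕ → ℝ≥0∞} (hmono : Monotone t)
    (hlt : ∀ k, t k < u) (ht : Tendsto t atTop (𝓝 u)) :
    Tendsto (fun k => work v (t k)) atTop (𝓝 (work v u)) := by
  set μ : Measure ℝ := volume.withDensity fun τ => ENNReal.ofReal (v τ) with hμ
  have hmeas : ∀ r : ℝ≥0∞, MeasurableSet {τ : ℝ | 0 ≤ τ ∧ ENNReal.ofReal τ ≤ r} := fun r =>
    (measurableSet_le measurable_const measurable_id).inter
      (measurableSet_le ENNReal.measurable_ofReal measurable_const)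
  have hw : ∀ r, work v r = μ {τ : ℝ | 0 ≤ τ ∧ ENNReal.ofReal τ ≤ r} := fun r => by
    rw [hμ, withDensity_apply _ (hmeas r)]
    rfl
  have hU := tendsto_measure_iUnion_atTop (μ := μ)
    (s := fun k => {τ : ℝ | 0 ≤ τ ∧ ENNReal.ofReal τ ≤ t k})
    fun k l hkl τ hτ => ⟨hτ.1, hτ.2.trans (hmono hkl)⟩
  have e : work v u = μ (⋃ k, {τ : ℝ | 0 ≤ τ ∧ ENNReal.ofReal τ ≤ t k}) := by
    rw [hw]
    refine le_antisymm ?_ (measure_mono (Set.iUnion_subset fun k τ hτ =>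
      ⟨hτ.1, hτ.2.trans (hlt k).le⟩))
    have hsub : {τ : ℝ | 0 ≤ τ ∧ ENNReal.ofReal τ ≤ u} ⊆
        (⋃ k, {τ : ℝ | 0 ≤ τ ∧ ENNReal.ofReal τ ≤ t k}) ∪ {u.toReal} := fun τ hτ => by
      rcases hτ.2.lt_or_eq with h | h
      · obtain ⟨k, hk⟩ := (ht.eventually (lt_mem_nhds h)).exists
        exact Or.inl (Set.mem_iUnion.2 ⟨k, hτ.1, hk.le⟩)
      · refine Or.inr ?_
        rw [Set.mem_singleton_iff, ← h, ENNReal.toReal_ofReal hτ.1]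
    refine (measure_mono hsub).trans ((measure_union_le _ _).trans ?_)
    have h0 : μ {u.toReal} = 0 :=
      withDensity_absolutelyContinuous _ _ (measure_singleton u.toReal)
    rw [h0, add_zero]
  rw [e]
  simpa only [hw, Function.comp_def] using hU

/-- A real number that is at least `1` is at most twice its floor, so the floors cost only a factor
`2`. The literal `1 *` is the constant `c₃`. -/
lemma inv_floor_le {ℓ : ℝ} (hℓ : 1 ≤ ℓ) {r : ℝ≥0∞} (hr : r ≠ ⊤) (h : ENNReal.ofReal ℓ < r) :
    1 ≤ ⌊1 * r.toReal / ℓ⌋₊ ∧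
      ((⌊1 * r.toReal / ℓ⌋₊ : ℕ) : ℝ≥0∞)⁻¹ ≤ ENNReal.ofReal (2 * ℓ) * r⁻¹ := by
  have hr1 : ℓ < r.toReal := (ENNReal.ofReal_lt_iff_lt_toReal (by linarith) hr).1 h
  rw [one_mul]
  have hb : 1 ≤ ⌊r.toReal / ℓ⌋₊ := by
    refine Nat.le_floor ?_
    rw [Nat.cast_one, one_le_div (by linarith)]
    exact hr1.le
  refine ⟨hb, ?_⟩
  have hb' : (1 : ℝ) ≤ ⌊r.toReal / ℓ⌋₊ := by exact_mod_cast hb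
  have h1 : r.toReal ≤ 2 * ℓ * ⌊r.toReal / ℓ⌋₊ := by
    have := (Nat.lt_floor_add_one (r.toReal / ℓ)).le
    rw [div_le_iff₀ (by linarith)] at this
    nlinarith
  have h2 : r ≤ ENNReal.ofReal (2 * ℓ) * (⌊r.toReal / ℓ⌋₊ : ℕ) := by
    rw [← ENNReal.ofReal_natCast, ← ENNReal.ofReal_mul (by linarith)]
    exact (ENNReal.le_ofReal_iff_toReal_le hr (by positivity)).2 h1
  rw [← div_eq_mul_inv, ENNReal.le_div_iff_mul_le (Or.inl (pos_of_gt h).ne') (Or.inl hr), mul_comm]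
  exact ENNReal.div_le_of_le_mul h2

/-- At the end of a window, either some worker has done little work, or the total of the inverse
amounts of work is large. -/
lemma window_dichotomy {n : ℕ} (hn : 0 < n) {v : Fin n → ℝ → ℝ}
    (hv : ∀ i, IsComputationPower (v i)) {ℓ M : ℝ} (hℓ : 1 ≤ ℓ) {s u : ℝ≥0∞}
    (hu : u = sInf ((fun t : ℝ≥0 => (t : ℝ≥0∞)) '' {t : ℝ≥0 |
      ENNReal.ofReal (max M 1) ≤ harmonicMean (fun i => scaledCount (v i) 1 ℓ s t)})) :
    (∃ i, work (v i) u - work (v i) s ≤ ENNReal.ofReal ℓ) ∨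
    ((∀ i, ENNReal.ofReal ℓ < work (v i) u - work (v i) s) ∧ 1 < M ∧
      (n : ℝ≥0∞) * (ENNReal.ofReal M)⁻¹ ≤
        ENNReal.ofReal (2 * ℓ) * ∑ i, (work (v i) u - work (v i) s)⁻¹) := by
  by_cases hA : ∃ i, work (v i) u - work (v i) s ≤ ENNReal.ofReal ℓ
  · exact Or.inl hA
  refine Or.inr ?_
  push Not at hA
  have hn0 : (n : ℝ≥0∞) ≠ 0 := by exact_mod_cast hn.ne'
  have hW0 : ∀ i, work (v i) u - work (v i) s ≠ 0 := fun i => (pos_of_gt (hA i)).ne'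
  -- A window starting at `∞` has no work in it and falls under the first alternative.
  have hs : s ≠ ⊤ := by
    rintro rfl
    exact hW0 ⟨0, hn⟩ (tsub_eq_zero_of_le (work_mono _ le_top))
  have hu0 : 0 < u := by
    refine pos_iff_ne_zero.2 ?_
    rintro h
    refine hW0 ⟨0, hn⟩ ?_
    rw [h, work_zero, zero_tsub]
  -- The condition fails at every time before `u`; the floors are removed there, and only then is
  -- the limit at `u` taken.
  obtain ⟨t, tmono, tlt, ttend⟩ := exists_seq_strictMono_tendsto' hu0
  have htend : ∀ i, Tendsto (fun k => work (v i) (t k) - work (v i) s) atTop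
      (𝓝 (work (v i) u - work (v i) s)) := fun i =>
    ENNReal.Tendsto.sub (tendsto_work (v i) tmono.monotone (fun k => (tlt k).2) ttend)
      tendsto_const_nhds (Or.inr (work_ne_top (hv i) hs))
  have hev : ∀ᶠ k in atTop, ∀ i, ENNReal.ofReal ℓ < work (v i) (t k) - work (v i) s :=
    eventually_all.2 fun i => (htend i).eventually (lt_mem_nhds (hA i))
  have key : ∀ᶠ k in atTop, 1 < M ∧ (n : ℝ≥0∞) * (ENNReal.ofReal M)⁻¹ ≤
      ENNReal.ofReal (2 * ℓ) * ∑ i, (work (v i) (t k) - work (v i) s)⁻¹ := by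
    filter_upwards [hev] with k hk
    have htop : t k ≠ ⊤ := ((tlt k).2.trans_le le_top).ne
    have hr : ((t k).toNNReal : ℝ≥0∞) = t k := ENNReal.coe_toNNReal htop
    generalize (t k).toNNReal = r at hr
    have hlt : harmonicMean (fun i => scaledCount (v i) 1 ℓ s r) < ENNReal.ofReal (max M 1) := by
      by_contra hcon
      have hmem : (r : ℝ≥0∞) ∈ (fun t : ℝ≥0 => (t : ℝ≥0∞)) '' {t : ℝ≥0 |
        ENNReal.ofReal (max M 1) ≤ harmonicMean (fun i => scaledCount (v i) 1 ℓ s t)} :=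
        ⟨r, not_lt.1 hcon, rfl⟩
      have := sInf_le hmem
      rw [← hu, hr] at this
      exact absurd (tlt k).2 (not_lt.2 this)
    have hfl : ∀ i, 1 ≤ scaledCount (v i) 1 ℓ s r ∧ ((scaledCount (v i) 1 ℓ s r : ℕ) : ℝ≥0∞)⁻¹ ≤
        ENNReal.ofReal (2 * ℓ) * (work (v i) (t k) - work (v i) s)⁻¹ := fun i => by
      unfold scaledCount
      rw [hr]
      exact inv_floor_le hℓ (ENNReal.sub_ne_top (work_ne_top (hv i) htop)) (hk i)
    have hone : 1 ≤ harmonicMean (fun i => scaledCount (v i) 1 ℓ s r) := by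
      unfold harmonicMean
      rw [ENNReal.one_le_inv]
      refine ENNReal.div_le_of_le_mul ?_
      rw [one_mul]
      refine (Finset.sum_le_card_nsmul _ _ 1 fun i _ => ?_).trans ?_
      · rw [ENNReal.inv_le_one]
        exact_mod_cast (hfl i).1
      · simp
    -- All floors are at least `1`, hence so is the harmonic mean; a threshold of `1` would have
    -- been reached before `u`.
    have hM : 1 < M := by
      by_contra hcon
      rw [max_eq_right (not_lt.1 hcon), ENNReal.ofReal_one] at hlt
      exact absurd hlt (not_lt.2 hone)
    refine ⟨hM, ?_⟩
    rw [max_eq_left hM.le, harmonicMean, ENNReal.inv_lt_iff_inv_lt] at hlt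
    have h1 := ENNReal.mul_le_of_le_div' hlt.le
    refine (le_trans (by rw [mul_comm]) h1).trans ?_
    rw [Finset.mul_sum]
    exact Finset.sum_le_sum fun i _ => (hfl i).2
  refine ⟨hA, key.exists.choose_spec.1, ?_⟩
  refine ge_of_tendsto (ENNReal.Tendsto.const_mul (tendsto_finsetSum _ fun i _ =>
    (htend i).inv) (Or.inr ENNReal.ofReal_ne_top)) (key.mono fun k hk => hk.2)

/-- Weights of the workers and heads probabilities for one block and one window: the weights are
compatible with the variance bound, and few heads are expected in the window. -/
theorem exists_block_weights {n : ℕ} (hn : 0 < n) {v : Fin n → ℝ → ℝ}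
    (hv : ∀ i, IsComputationPower (v i)) {ℓ σ ε : ℝ} (hℓ : 1 ≤ ℓ) (hε : 0 < ε) {s u : ℝ≥0∞}
    (hu : u = sInf ((fun t : ℝ≥0 => (t : ℝ≥0∞)) '' {t : ℝ≥0 |
      ENNReal.ofReal (max (1 / 64 * (σ ^ 2 / (n * ε))) 1) ≤
        harmonicMean (fun i => scaledCount (v i) 1 ℓ s t)})) :
    ∃ (w : Fin n → ℝ) (p : Fin n → ℝ≥0), (∀ i, 0 ≤ w i) ∧ ∑ i, w i = n ∧ (∀ i, p i ≤ 1) ∧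
      (∀ i, 32 * ε * w i ^ 2 * (1 - p i) ≤ σ ^ 2 * p i) ∧
      ∑ i, (p i : ℝ≥0∞) * (1 + (work (v i) u - work (v i) s)) ≤ ENNReal.ofReal (2 * ℓ) := by
  have hnR : (0 : ℝ) < n := by exact_mod_cast hn
  rcases window_dichotomy hn hv hℓ hu with ⟨i, hi⟩ | ⟨hW, hM, hH⟩
  · classical
    -- The slow worker carries the whole block and always shows heads; its number of calls is itself
    -- small enough.
    refine ⟨fun j => if j = i then n else 0, fun j => if j = i then 1 else 0, fun j => ?_, ?_,
      fun j => ?_, fun j => ?_, ?_⟩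
    · dsimp only
      split_ifs <;> positivity
    · simp
    · dsimp only
      split_ifs <;> simp
    · dsimp only
      split_ifs <;> simp [sq_nonneg]
    · rw [Finset.sum_eq_single i (fun j _ hj => by simp [hj]) (by simp)]
      simp only [if_true, ENNReal.coe_one, one_mul]
      refine (add_le_add_right hi 1).trans ?_
      rw [← ENNReal.ofReal_one, ← ENNReal.ofReal_add zero_le_one (by linarith)]
      exact ENNReal.ofReal_le_ofReal (by linarith)
  · have hσ : 0 < σ ^ 2 := by
      refine lt_of_le_of_ne (sq_nonneg σ) fun h => ?_
      rw [← h] at hM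
      norm_num at hM
    set W : Fin n → ℝ≥0∞ := fun i => work (v i) u - work (v i) s with hWdef
    have hW0 : ∀ i, (W i)⁻¹ ≠ ⊤ := fun i => ENNReal.inv_ne_top.2 (pos_of_gt (hW i)).ne'
    set y : Fin n → ℝ := fun i => ((W i)⁻¹).toReal with hy
    have hy0 : ∀ i, 0 ≤ y i := fun i => ENNReal.toReal_nonneg
    have hyof : ∀ i, ENNReal.ofReal (y i) = (W i)⁻¹ := fun i => ENNReal.ofReal_toReal (hW0 i)
    set H : ℝ := ∑ i, y i with hHdef
    clear_value H
    -- The inequality `n / M ≤ 2ℓH` with `M = σ² / (64nε)`; the choice `c₂ = 1/64` matches `a² =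
    -- 32ε`.
    have hH' : 32 * n ^ 2 * ε ≤ ℓ * σ ^ 2 * H := by
      have e : ∑ i, (W i)⁻¹ = ENNReal.ofReal H := by
        rw [hHdef, ENNReal.ofReal_sum_of_nonneg fun i _ => hy0 i]
        exact Finset.sum_congr rfl fun i _ => (hyof i).symm
      have hH2 : (n : ℝ≥0∞) * (ENNReal.ofReal (1 / 64 * (σ ^ 2 / (n * ε))))⁻¹ ≤
        ENNReal.ofReal (2 * ℓ) * ∑ i, (W i)⁻¹ := hH
      rw [e, ← ENNReal.ofReal_natCast, ← ENNReal.ofReal_inv_of_pos (by linarith),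
        ← ENNReal.ofReal_mul hnR.le, ← ENNReal.ofReal_mul (by linarith),
        ENNReal.ofReal_le_ofReal_iff (mul_nonneg (by linarith)
          (hHdef ▸ Finset.sum_nonneg fun i _ => hy0 i))] at hH2
      have e2 : (n : ℝ) * (1 / 64 * (σ ^ 2 / (n * ε)))⁻¹ = 64 * n ^ 2 * ε / σ ^ 2 := by
        field_simp
      rw [e2, div_le_iff₀ hσ] at hH2
      linarith
    have hHpos : 0 < H := by
      by_contra hcon
      have h1 : ℓ * σ ^ 2 * H ≤ 0 := mul_nonpos_of_nonneg_of_nonpos (by positivity) (not_lt.1 hcon)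
      have h2 : 0 < 32 * (n : ℝ) ^ 2 * ε := by positivity
      linarith
    -- Weights proportional to inverse work minimise `∑ w_i² W_i` under `∑ w_i = n`; `p` is the
    -- smallest probability the variance allows, capped at `1`.
    set w : Fin n → ℝ := fun i => n * y i / H with hw
    have hw0 : ∀ i, 0 ≤ w i := fun i => div_nonneg (mul_nonneg hnR.le (hy0 i)) hHpos.le
    set p : Fin n → ℝ≥0 := fun i => min 1 (Real.toNNReal (32 * ε * w i ^ 2 / σ ^ 2)) with hp
    have hq0 : ∀ i, 0 ≤ 32 * ε * w i ^ 2 / σ ^ 2 := fun i => by positivity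
    have hpc : ∀ i, (p i : ℝ) = min 1 (32 * ε * w i ^ 2 / σ ^ 2) := fun i => by
      simp only [hp]
      rw [NNReal.coe_min, Real.coe_toNNReal _ (hq0 i), NNReal.coe_one]
    refine ⟨w, p, hw0, ?_, fun i => min_le_left _ _, fun i => ?_, ?_⟩
    · simp only [hw]
      rw [← Finset.sum_div, ← Finset.mul_sum, ← hHdef]
      field_simp
    · rw [hpc]
      rcases min_cases 1 (32 * ε * w i ^ 2 / σ ^ 2) with ⟨h, -⟩ | ⟨h, h2⟩
      · rw [h]
        nlinarith
      · rw [h, mul_div_cancel₀ _ hσ.ne']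
        refine mul_le_of_le_one_right (by positivity) ?_
        linarith [hq0 i]
    · have hterm : ∀ i, (p i : ℝ≥0∞) * (1 + W i) ≤
          ENNReal.ofReal (64 * ε * n ^ 2 / (H ^ 2 * σ ^ 2) * y i) := fun i => by
        rcases (hy0 i).eq_or_lt with h | h
        -- Infinite work: the worker gets weight and probability zero, and `0 * ∞ = 0`.
        · have : p i = 0 := by
            simp [hp, hw, ← h]
          rw [this]
          simp
        · have hWi : W i = ENNReal.ofReal (1 / y i) := by
            rw [one_div, ENNReal.ofReal_inv_of_pos h, hyof, inv_inv]
          have hy1 : 1 ≤ 1 / y i := by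
            have h1 : ENNReal.ofReal ℓ < ENNReal.ofReal (1 / y i) := by
              rw [← hWi]
              exact hW i
            have := (ENNReal.ofReal_lt_ofReal_iff (by positivity)).1 h1
            linarith
          have hpi : (p i : ℝ≥0∞) ≤ ENNReal.ofReal (32 * ε * w i ^ 2 / σ ^ 2) := by
            rw [ENNReal.ofReal]
            exact_mod_cast min_le_right _ _
          have h1W : 1 + W i ≤ ENNReal.ofReal (2 * (1 / y i)) := by
            rw [hWi, ← ENNReal.ofReal_one, ← ENNReal.ofReal_add zero_le_one (by linarith)]
            exact ENNReal.ofReal_le_ofReal (by linarith)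
          refine (mul_le_mul' hpi h1W).trans ?_
          rw [← ENNReal.ofReal_mul (hq0 i)]
          refine ENNReal.ofReal_le_ofReal (le_of_eq ?_)
          simp only [hw]
          field_simp
          norm_num
      refine (Finset.sum_le_sum fun i _ => hterm i).trans ?_
      rw [← ENNReal.ofReal_sum_of_nonneg fun i _ => mul_nonneg (by positivity) (hy0 i)]
      refine ENNReal.ofReal_le_ofReal ?_
      rw [← Finset.mul_sum, ← hHdef, div_mul_eq_mul_div, div_le_iff₀ (by positivity)]
      nlinarith

end Weights

/-! ### Independent coins -/

section Coins

open MeasureTheory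

variable {ι : Type} [Fintype ι]

/-- The law of a coin that shows heads with probability `p`. -/
def coinMeasure (p : ℝ≥0) (hp : p ≤ 1) : Measure Bool :=
  ProbabilityTheory.bernoulliMeasure true false ⟨p, p.2, hp⟩

instance (p : ℝ≥0) (hp : p ≤ 1) : IsProbabilityMeasure (coinMeasure p hp) := by
  unfold coinMeasure
  infer_instance

/-- The law of independent coins, where coin `i` shows heads with probability `p i`. -/
def coinLaw (p : ι → ℝ≥0) (hp : ∀ i, p i ≤ 1) : Measure (ι → Bool) :=
  Measure.pi fun i => coinMeasure (p i) (hp i)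

instance (p : ι → ℝ≥0) (hp : ∀ i, p i ≤ 1) : IsProbabilityMeasure (coinLaw p hp) := by
  unfold coinLaw
  infer_instance

lemma measurePreserving_coin (p : ι → ℝ≥0) (hp : ∀ i, p i ≤ 1) (i : ι) :
    MeasurePreserving (fun y : ι → Bool => y i) (coinLaw p hp) (coinMeasure (p i) (hp i)) :=
  measurePreserving_eval (fun i => coinMeasure (p i) (hp i)) i

lemma coinLaw_heads (p : ι → ℝ≥0) (hp : ∀ i, p i ≤ 1) (i : ι) :
    coinLaw p hp {y | y i = true} = p i := by
  have h := (measurePreserving_coin p hp i).measure_preimage (s := {true})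
    (measurableSet_singleton true).nullMeasurableSet
  have h2 : coinMeasure (p i) (hp i) {true} = p i := by
    unfold coinMeasure
    rw [ProbabilityTheory.bernoulliMeasure_apply_of_mem_of_notMem _ (measurableSet_singleton true)
      (by simp) (by simp)]
    rfl
  rw [h2] at h
  exact h

lemma integral_coin {E : Type*} [NormedAddCommGroup E] [NormedSpace ℝ E] [CompleteSpace E]
    (p : ι → ℝ≥0) (hp : ∀ i, p i ≤ 1) (i : ι) (φ : Bool → E) :
    ∫ y, φ (y i) ∂coinLaw p hp = (p i : ℝ) • φ true + (1 - p i : ℝ) • φ false := by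
  have h := integral_map (μ := coinLaw p hp) (φ := fun y : ι → Bool => y i) (f := φ)
    (measurePreserving_coin p hp i).measurable.aemeasurable
    (StronglyMeasurable.of_discrete).aestronglyMeasurable
  rw [← h, (measurePreserving_coin p hp i).map_eq]
  exact ProbabilityTheory.integral_bernoulliMeasure _ _ _ φ

end Coins

/-! ### Gradients with one noisy coordinate -/

section Noise

open MeasureTheory

variable {d : ℕ}

/-- Add `r` times its coordinate `N` to a vector. -/
def perturb (u : Vec d) (N : ℕ) (r : ℝ) : Vec d :=
  if h : N < d then u + r • EuclideanSpace.single ⟨N, h⟩ (u ⟨N, h⟩) else u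

/-- The relative noise of a coordinate that is revealed with probability `p`. -/
def coinNoise (p : ℝ) (b : Bool) : ℝ := if b = true then 1 / p - 1 else -1

lemma prog_perturb_le_succ {u : Vec d} {N : ℕ} (hu : prog u ≤ N + 1) (r : ℝ) :
    prog (perturb u N r) ≤ N + 1 := by
  unfold perturb
  split_ifs with h
  · refine prog_le_iff.2 fun j hj => ?_
    have hne : j ≠ ⟨N, h⟩ := fun e => by
      rw [e] at hj
      simp at hj
    simp [prog_le_iff.1 hu j hj, hne]
  · exact hu

lemma prog_perturb_le {u : Vec d} {N : ℕ} (hu : prog u ≤ N + 1) :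
    prog (perturb u N (-1)) ≤ N := by
  unfold perturb
  split_ifs with h
  · refine prog_le_iff.2 fun j hj => ?_
    rcases hj.eq_or_lt with e | hlt
    · have : j = ⟨N, h⟩ := Fin.ext e.symm
      subst this
      simp
    · have hne : j ≠ ⟨N, h⟩ := fun e => by
        rw [e] at hlt
        simp at hlt
      simp [prog_le_iff.1 hu j hlt, hne]
  · refine prog_le_iff.2 fun j hj => ?_
    omega

lemma norm_perturb_sub_sq (u : Vec d) {N : ℕ} (h : N < d) (r : ℝ) :
    ‖perturb u N r - u‖ ^ 2 = r ^ 2 * u ⟨N, h⟩ ^ 2 := by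
  rw [perturb, dif_pos h, add_sub_cancel_left, norm_smul, mul_pow]
  simp

/-- A gradient that reveals one coordinate by a coin is a stochastic gradient. -/
lemma isStochasticGradient_perturb {ι : Type} [Fintype ι] {p : ι → ℝ≥0} (hp : ∀ i, p i ≤ 1)
    {σ : ℝ} {f : Vec d → ℝ} {G : Vec d → Vec d} (hG : ∀ x, HasGradientAt f (G x) x)
    (N : Vec d → ℕ) (i : Vec d → ι)
    (hvar : ∀ (x : Vec d) (h : N x < d), G x ⟨N x, h⟩ ^ 2 * (1 - p (i x)) ≤ σ ^ 2 * p (i x)) :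
    IsStochasticGradient σ (coinLaw p hp) f
      (fun x y _ => perturb (G x) (N x) (coinNoise (p (i x)) (y (i x)))) where
  integrable _ _ := Integrable.of_finite
  unbiased x _ := by
    rw [(hG x).gradient, integral_coin p hp (i x) fun b => perturb (G x) (N x) (coinNoise (p (i x)) b)]
    unfold perturb
    split_ifs with h
    · have hc : ((p (i x) : ℝ) * coinNoise (p (i x)) true +
          (1 - p (i x)) * coinNoise (p (i x)) false) * G x ⟨N x, h⟩ = 0 := by
        have hv := hvar x h
        simp only [coinNoise, if_true, Bool.false_eq_true, if_false]
        -- For `p = 0` the variance hypothesis forces the hidden coordinate to vanish, so the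
        -- default value of `1 / 0` is harmless.
        rcases eq_or_ne (p (i x) : ℝ) 0 with h0 | h0
        · rw [h0] at hv
          have : G x ⟨N x, h⟩ = 0 := pow_eq_zero_iff two_ne_zero |>.1
            (le_antisymm (by linarith) (sq_nonneg _))
          rw [this, mul_zero]
        · field_simp
          ring
      ext j
      by_cases hj : j = ⟨N x, h⟩
      · subst hj
        simp
        linarith
      · simp [hj]
        ring
    · ext j
      simp
  sq_integrable _ _ := Integrable.of_finite
  variance_le x _ := by
    rw [(hG x).gradient, integral_coin p hp (i x)
      fun b => ‖perturb (G x) (N x) (coinNoise (p (i x)) b) - G x‖ ^ 2]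
    by_cases h : N x < d
    · have hv := hvar x h
      rw [norm_perturb_sub_sq _ h, norm_perturb_sub_sq _ h]
      simp only [coinNoise, if_true, Bool.false_eq_true, if_false, smul_eq_mul]
      have hp0 : (0 : ℝ) ≤ p (i x) := NNReal.zero_le_coe
      rcases hp0.eq_or_lt with h0 | h0
      · rw [← h0] at hv ⊢
        nlinarith [sq_nonneg σ]
      · have e : (p (i x) : ℝ) * ((1 / p (i x) - 1) ^ 2 * G x ⟨N x, h⟩ ^ 2) +
            (1 - p (i x)) * ((-1) ^ 2 * G x ⟨N x, h⟩ ^ 2) =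
            G x ⟨N x, h⟩ ^ 2 * (1 - p (i x)) / p (i x) := by
          field_simp
          ring
        rw [e, div_le_iff₀ h0]
        exact hv
    · simp [perturb, h, sq_nonneg]

end Noise

/-! ### The best gradient norm -/

section Best

open MeasureTheory

variable {n d : ℕ} {Ξ : Type} (v : Fin n → ℝ → ℝ) (g : Fin n → Vec d → Ξ → ℝ≥0 → Vec d)
  {A : Algorithm n d} (f : Vec d → ℝ) (t : ℝ≥0∞)

lemma zero_mem_indicesUpTo (ξ : ℕ → Ξ) : 0 ∈ indicesUpTo v g A ξ t := by
  simp [indicesUpTo, time]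

lemma iterate_zero (hA : IsZeroRespecting A) (ξ : ℕ → Ξ) : iterate v g A ξ 0 = 0 := by
  ext l
  by_contra h
  obtain ⟨j, -⟩ := hA.supp_subset 0 _ l h
  exact j.elim0

lemma bestSqGrad_nonneg (ξ : ℕ → Ξ) : 0 ≤ bestSqGrad v g A f t ξ :=
  Real.iInf_nonneg fun _ => sq_nonneg _

lemma bddBelow_sqGrad (ξ : ℕ → Ξ) : BddBelow (Set.range fun k : indicesUpTo v g A ξ t =>
    ‖gradient f (iterate v g A ξ k)‖ ^ 2) :=
  ⟨0, by
    rintro _ ⟨k, rfl⟩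
    positivity⟩

lemma bestSqGrad_le (hA : IsZeroRespecting A) (ξ : ℕ → Ξ) :
    bestSqGrad v g A f t ξ ≤ ‖gradient f 0‖ ^ 2 := by
  have := ciInf_le (bddBelow_sqGrad (A := A) v g f t ξ)
    ⟨0, zero_mem_indicesUpTo v g t ξ⟩
  rwa [iterate_zero v g hA ξ] at this

-- The index set is random. Filling the gaps with the value at `k = 0`, which always competes, gives
-- an infimum over all of `ℕ` and hence measurability.
open Classical in
lemma bestSqGrad_eq (hA : IsZeroRespecting A) (ξ : ℕ → Ξ) : bestSqGrad v g A f t ξ =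
    ⨅ k : ℕ, if k ∈ indicesUpTo v g A ξ t then ‖gradient f (iterate v g A ξ k)‖ ^ 2
      else ‖gradient f 0‖ ^ 2 := by
  have : Nonempty (indicesUpTo v g A ξ t) := ⟨⟨0, zero_mem_indicesUpTo v g t ξ⟩⟩
  refine le_antisymm (le_ciInf fun k => ?_) (le_ciInf fun k => ?_)
  · split_ifs with h
    · exact ciInf_le (bddBelow_sqGrad v g f t ξ) ⟨k, h⟩
    · exact bestSqGrad_le v g f t hA ξ
  · refine (ciInf_le ⟨0, ?_⟩ (k : ℕ)).trans (le_of_eq (if_pos k.2))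
    rintro _ ⟨l, rfl⟩
    dsimp only
    split_ifs <;> positivity

lemma measurable_bestSqGrad [MeasurableSpace Ξ] [Finite Ξ] [MeasurableSingletonClass Ξ]
    (hA : IsZeroRespecting A) : Measurable (bestSqGrad v g A f t) := by
  classical
  rw [funext (bestSqGrad_eq v g f t hA)]
  refine Measurable.iInf fun k => Local.measurable (k := k) fun ξ ξ' h => ?_
  have e := local_run v g A k ξ ξ' h
  have e1 : iterate v g A ξ k = iterate v g A ξ' k := by
    simp only at e
    simp only [iterate, e]
  have e2 : time v g A ξ k = time v g A ξ' k := by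
    cases k with
    | zero => rfl
    | succ k =>
      have := local_run v g A k ξ ξ' fun j hj => h j (hj.trans (Nat.lt_succ_self k))
      simp only at this
      simp only [time, this]
  have e3 : k ∈ indicesUpTo v g A ξ t ↔ k ∈ indicesUpTo v g A ξ' t := by
    simp only [indicesUpTo, Set.mem_ofPred_eq, e2]
  rw [e1]
  exact if_congr e3 rfl rfl

lemma integrable_bestSqGrad [MeasurableSpace Ξ] [Finite Ξ] [MeasurableSingletonClass Ξ]
    (D : Measure Ξ) [IsProbabilityMeasure D] (hA : IsZeroRespecting A) :
    Integrable (bestSqGrad v g A f t) (draws D) := by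
  refine Integrable.of_bound (measurable_bestSqGrad v g f t hA).aestronglyMeasurable
    (‖gradient f 0‖ ^ 2) (Filter.Eventually.of_forall fun ξ => ?_)
  rw [Real.norm_eq_abs, abs_of_nonneg (bestSqGrad_nonneg v g f t ξ)]
  exact bestSqGrad_le v g f t hA ξ

end Best

/-! ### The hard instance -/

section Instance

open MeasureTheory

variable {n d : ℕ}

lemma average_scaledChain (hn : 0 < n) (a lam : ℝ) {w : Fin n → ℕ → ℝ} {w₀ : ℕ → ℝ}
    (h : ∀ j, ∑ i, w i j = n * w₀ j) :
    average (fun i => (scaledChain a lam (w i) : Vec d → ℝ)) = scaledChain a lam w₀ := by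
  have hn' : (n : ℝ) ≠ 0 := by exact_mod_cast hn.ne'
  funext x
  unfold average scaledChain chain
  rw [← Finset.mul_sum, Finset.sum_comm]
  simp only [← Finset.sum_mul, h, mul_assoc, ← Finset.mul_sum]
  field_simp

lemma firstWeights_of_le {T j : ℕ} (h : T ≤ j) : firstWeights T j = 0 := by
  simp [firstWeights, not_lt.2 h]

/-- The length scale `18a/L` turns the Lipschitz constant `18` into `L`; the gap is `4T` times `a *
(18a/L)`, whence `72`. -/
lemma inClass_scaledChain {T : ℕ} (hTd : T ≤ d) {L Δ a : ℝ} (hL : 0 < L) (ha : 0 < a)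
    (hgap : 72 * a ^ 2 * T ≤ L * Δ) :
    InClass L Δ (scaledChain a (18 * a / L) (firstWeights T) : Vec d → ℝ) := by
  have hlam : 18 * a / L ≠ 0 := by positivity
  have hgrad := hasGradientAt_scaledChain (d := d) (firstWeights_of_le hTd) a hlam
  refine ⟨fun x => (hgrad x).differentiableAt, fun x y => ?_, -(72 * a ^ 2 * T / L), fun x => ?_, ?_⟩
  · rw [(hgrad x).gradient, (hgrad y).gradient, ← smul_sub, norm_smul, Real.norm_eq_abs,
      abs_of_pos ha]
    have h := norm_chainGrad_sub_le (T := T) ((18 * a / L)⁻¹ • x) ((18 * a / L)⁻¹ • y)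
    rw [← smul_sub, norm_smul, norm_inv, Real.norm_eq_abs, abs_of_pos (by positivity)] at h
    calc _ ≤ a * (18 * ((18 * a / L)⁻¹ * ‖x - y‖)) := by gcongr
      _ = _ := by field_simp
  · have h := chain_firstWeights_ge hTd ((18 * a / L)⁻¹ • x)
    unfold scaledChain
    calc -(72 * a ^ 2 * T / L) = a * (18 * a / L) * -(4 * (T : ℝ)) := by
          ring
      _ ≤ _ := by gcongr
  · have h := chain_firstWeights_zero_le (d := d) (T := T)
    have h0 : scaledChain a (18 * a / L) (firstWeights T) (0 : Vec d) ≤ 0 := by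
      unfold scaledChain
      rw [smul_zero]
      exact mul_nonpos_of_nonneg_of_nonpos (by positivity) h
    have : 72 * a ^ 2 * T / L ≤ Δ := by
      rw [div_le_iff₀ hL]
      linarith
    linarith

/-- The gradient of the scaled chain where the next coordinate is revealed by a coin. -/
def coinGrad {ι : Type} (a lam : ℝ) (w : ℕ → ℝ) (p : ι → ℝ≥0) (c : ℕ → ι) (x : Vec d)
    (y : ι → Bool) (_ : ℝ≥0) : Vec d :=
  perturb (a • chainGrad w (lam⁻¹ • x)) (prog x) (coinNoise (p (c (prog x))) (y (c (prog x))))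

lemma prog_smul_chainGrad_le (a lam : ℝ) (w : ℕ → ℝ) (x : Vec d) :
    prog (a • chainGrad w (lam⁻¹ • x)) ≤ prog x + 1 := by
  refine (prog_smul_le _ _).trans (prog_le_iff.2 fun j hj => ?_)
  exact chainGrad_eq_zero_of_prog_lt w ((prog_smul_le _ _).trans_lt (Nat.lt_of_succ_le hj))

/-- From a point with `prog x < N` even heads cannot lead past `N`; for `prog x = N`, tails erases
exactly the new coordinate. -/
lemma gatedBy_coinGrad {ι : Type} (a lam : ℝ) (w : Fin n → ℕ → ℝ) (p : ι → ℝ≥0)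
    (c : Fin n → ℕ → ι) (m : ℕ) :
    GatedBy (fun i => coinGrad (d := d) a lam (w i) p fun N => c i (N / m))
      (fun i b y => y (c i b)) m := by
  intro i x y t N hN
  have hp := prog_smul_chainGrad_le a lam (w i) x
  have h1 : prog (coinGrad a lam (w i) p (fun N => c i (N / m)) x y t) ≤ prog x + 1 :=
    prog_perturb_le_succ hp _
  refine ⟨h1.trans (Nat.succ_le_succ hN), fun hc => ?_⟩
  dsimp only at hc ⊢
  rcases hN.lt_or_eq with hlt | rfl
  · exact h1.trans hlt
  · unfold coinGrad
    rw [hc]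
    exact prog_perturb_le hp

lemma isStochasticGradient_coinGrad {ι : Type} [Fintype ι] {a lam σ : ℝ} (hlam : lam ≠ 0)
    {w : ℕ → ℝ} (hw : w d = 0) (hw0 : ∀ j, 0 ≤ w j) {p : ι → ℝ≥0} (hp : ∀ i, p i ≤ 1) (c : ℕ → ι)
    (hvar : ∀ j, a ^ 2 * w j ^ 2 * (1 - p (c j)) ≤ σ ^ 2 * p (c j)) :
    IsStochasticGradient σ (coinLaw p hp) (scaledChain a lam w : Vec d → ℝ)
      (coinGrad a lam w p c) := by
  refine isStochasticGradient_perturb hp (hasGradientAt_scaledChain hw a hlam) prog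
    (fun x => c (prog x)) fun x h => le_trans ?_ (hvar (prog x))
  have h1 : (0 : ℝ) ≤ 1 - p (c (prog x)) := by
    have : (p (c (prog x)) : ℝ) ≤ 1 := by exact_mod_cast hp _
    linarith
  refine mul_le_mul_of_nonneg_right ?_ h1
  rw [PiLp.smul_apply, smul_eq_mul, mul_pow]
  refine mul_le_mul_of_nonneg_left ?_ (sq_nonneg a)
  rw [← sq_abs]
  exact pow_le_pow_left₀ (abs_nonneg _) (abs_chainGrad_le_of_prog_le (hw0 (prog x))
    (j := ⟨prog x, h⟩) (prog_smul_le _ _)) 2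

/-- The blocks of the chain are discovered no faster than one per window, up to a small
probability, so that the gradient of the chain stays large. -/
theorem lt_integral_bestSqGrad {v : Fin n → ℝ → ℝ} (hv : ∀ i, IsComputationPower (v i))
    {A : Algorithm n d} (hA : IsZeroRespecting A) {Ξ : Type} [MeasurableSpace Ξ] [Finite Ξ]
    [MeasurableSingletonClass Ξ] (D : Measure Ξ) [IsProbabilityMeasure D]
    {g : Fin n → Vec d → Ξ → ℝ≥0 → Vec d} {coin : Fin n → ℕ → Ξ → Bool} {m K : ℕ}
    (hg : GatedBy g coin m) {p : ℕ → Fin n → ℝ≥0}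
    (hp : ∀ b i, D {y | coin i b y = true} = p b i) {T : ℕ → ℝ≥0∞} (hT : T 0 = 0)
    (hwork : ∀ b < K, ∑ i, (p b i : ℝ≥0∞) * (1 + (work (v i) (T (b + 1)) - work (v i) (T b))) ≤
      ENNReal.ofReal ((m : ℝ) / 4))
    (hK : K * Real.exp (-((m : ℝ) / 4)) < 1 / 2) {f : Vec d → ℝ} {ε : ℝ} (hε : 0 < ε)
    (hf : ∀ x, prog x ≤ K * m → 2 * ε ≤ ‖gradient f x‖ ^ 2) {t : ℝ≥0∞} (ht : t ≤ T K) :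
    ε < ∫ ξ, bestSqGrad v g A f t ξ ∂draws D := by
  set bad : ℕ → Set (ℕ → Ξ) := fun b =>
    {ξ | ∃ k, m ≤ headCount v g A ξ (fun i => coin i b) (T b) (T (b + 1)) k} with hbad
  have hgood : {ξ | 2 * ε ≤ bestSqGrad v g A f t ξ}ᶜ ⊆ ⋃ b ∈ Finset.range K, bad b := by
    intro ξ hξ
    by_contra hcon
    refine hξ ?_
    have hS : ∀ b < K, ∀ k, headCount v g A ξ (fun i => coin i b) (T b) (T (b + 1)) k < m := by
      intro b hb k
      by_contra hk
      exact hcon (Set.mem_biUnion (Finset.mem_coe.2 (Finset.mem_range.2 hb)) ⟨k, not_lt.1 hk⟩)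
    -- Outside the bad events every iterate up to time `T K` lives on the first `K * m` coordinates.
    have hdisc := discovered_le v ξ hA hg hT hS K le_rfl
    have : Nonempty (indicesUpTo v g A ξ t) := ⟨⟨0, zero_mem_indicesUpTo v g t ξ⟩⟩
    rw [Set.mem_ofPred_eq]
    refine le_ciInf fun k => hf _ ((prog_iterate_le v g ξ hA k).trans (hdisc k ?_))
    exact le_trans k.2 ht
  have hprob : (draws D).real {ξ | 2 * ε ≤ bestSqGrad v g A f t ξ}ᶜ < 1 / 2 := by
    refine lt_of_le_of_lt ?_ hK
    have h1 : draws D {ξ | 2 * ε ≤ bestSqGrad v g A f t ξ}ᶜ ≤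
        ENNReal.ofReal (K * Real.exp (-((m : ℝ) / 4))) := by
      refine (measure_mono hgood).trans ((measure_biUnion_finset_le _ _).trans ?_)
      refine (Finset.sum_le_card_nsmul _ _ _ fun b hb => measure_headCount_ge_le g hv hA D
        (hp b) (T b) (T (b + 1)) m (hwork b (Finset.mem_range.1 hb))).trans ?_
      rw [Finset.card_range, nsmul_eq_mul, ENNReal.ofReal_mul (Nat.cast_nonneg K),
        ENNReal.ofReal_natCast]
    exact ENNReal.toReal_le_of_le_ofReal (by positivity) h1
  have hmeas : MeasurableSet {ξ | 2 * ε ≤ bestSqGrad v g A f t ξ} :=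
    measurableSet_le measurable_const (measurable_bestSqGrad v g f t hA)
  rw [probReal_compl_eq_one_sub hmeas] at hprob
  have hmarkov := mul_meas_ge_le_integral_of_nonneg
    (Filter.Eventually.of_forall (bestSqGrad_nonneg v g f t))
    (integrable_bestSqGrad v g f t D hA) (2 * ε)
  nlinarith

/-- The weights of the links in the local function of one worker, given its weights in the blocks
of length `m`; the last link, after `K` blocks, has weight one. -/
def linkWeights (K m : ℕ) (w : ℕ → ℝ) (j : ℕ) : ℝ :=
  if j < K * m + 1 then (if j / m < K then w (j / m) else 1) else 0

/-- The heads probabilities that go with `linkWeights`. -/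
def blockProb (K : ℕ) (p : ℕ → Fin n → ℝ≥0) (z : Fin n × Fin (K + 1)) : ℝ≥0 :=
  if (z.2 : ℕ) < K then p z.2 z.1 else 1

/-- The coin of worker `i` for block `b`. -/
def blockCoin (K : ℕ) (i : Fin n) (b : ℕ) : Fin n × Fin (K + 1) := (i, Fin.ofNat (K + 1) (min b K))

/-- All blocks from `K` on share one coin per worker, which always shows heads; this keeps the
sample space finite. -/
lemma blockProb_blockCoin (K : ℕ) (p : ℕ → Fin n → ℝ≥0) (i : Fin n) (b : ℕ) :
    blockProb K p (blockCoin K i b) = if b < K then p b i else 1 := by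
  have h : ((Fin.ofNat (K + 1) (min b K) : Fin (K + 1)) : ℕ) = min b K := by
    rw [Fin.val_ofNat]
    exact Nat.mod_eq_of_lt (by omega)
  unfold blockProb blockCoin
  simp only [h]
  by_cases hb : b < K
  · rw [min_eq_left hb.le]
  · simp [hb]

/-- The lower bound for `K` blocks of length `m`. -/
theorem exists_hard_instance (hn : 0 < n) {v : Fin n → ℝ → ℝ}
    (hv : ∀ i, IsComputationPower (v i)) {L Δ ε σ ℓ : ℝ} (hL : 0 < L) (hε : 0 < ε) (hℓ : 1 ≤ ℓ)
    {K m : ℕ} (hm : 8 * ℓ ≤ m) (hgap : 2304 * ε * (K * m + 1) ≤ L * Δ)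
    (hK : K * Real.exp (-((m : ℝ) / 4)) < 1 / 2) (hd : K * m + 1 ≤ d) {A : Algorithm n d}
    (hA : IsZeroRespecting A) :
    ∃ (f : Fin n → Vec d → ℝ) (Ξ : Type) (_ : MeasurableSpace Ξ) (D : Measure Ξ)
      (_ : IsProbabilityMeasure D) (g : Fin n → Vec d → Ξ → ℝ≥0 → Vec d),
      (∀ i, Differentiable ℝ (f i)) ∧ InClass L Δ (average f) ∧
      (∀ i, IsStochasticGradient σ D (f i) (g i)) ∧
      ∀ t ≤ lowerTime v (1 / 64) 1 ℓ σ ε K,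
        Integrable (bestSqGrad v g A (average f) t) (draws D) ∧
        ε < ∫ ξ, bestSqGrad v g A (average f) t ξ ∂draws D := by
  set T : ℕ → ℝ≥0∞ := lowerTime v (1 / 64) 1 ℓ σ ε with hT
  have hblock := fun b : ℕ => exists_block_weights hn hv (σ := σ) (ε := ε) (s := T b)
    (u := T (b + 1)) hℓ hε rfl
  choose w p hw0 hwsum hp1 hvar hwork using hblock
  set a : ℝ := Real.sqrt (32 * ε) with ha_def
  have ha : 0 < a := Real.sqrt_pos.2 (by linarith)
  have ha2 : a ^ 2 = 32 * ε := Real.sq_sqrt (by linarith)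
  have hlam : 18 * a / L ≠ 0 := by positivity
  -- The extra link keeps the last coordinate undiscovered after all `K` blocks, and the chain
  -- nonempty when `K = 0`.
  set N : ℕ := K * m + 1 with hN
  set W : Fin n → ℕ → ℝ := fun i => linkWeights K m fun b => w b i with hW
  have hW0 : ∀ i j, 0 ≤ W i j := fun i j => by
    simp only [hW, linkWeights]
    split_ifs
    · exact hw0 _ _
    · exact zero_le_one
    · exact le_rfl
  have hWd : ∀ i, W i d = 0 := fun i => if_neg (not_lt.2 hd)
  have hWsum : ∀ j, ∑ i, W i j = n * firstWeights N j := fun j => by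
    simp only [hW, linkWeights, firstWeights]
    split_ifs
    · rw [hwsum, mul_one]
    · simp
    · simp
  have hP1 : ∀ z, blockProb K p z ≤ 1 := fun z => by
    unfold blockProb
    split_ifs
    · exact hp1 _ _
    · exact le_rfl
  have havg : average (fun i => (scaledChain a (18 * a / L) (W i) : Vec d → ℝ)) =
      scaledChain a (18 * a / L) (firstWeights N) := average_scaledChain hn _ _ hWsum
  refine ⟨fun i => scaledChain a (18 * a / L) (W i), Fin n × Fin (K + 1) → Bool, inferInstance,
    coinLaw (blockProb K p) hP1, inferInstance,
    fun i => coinGrad a (18 * a / L) (W i) (blockProb K p) fun j => blockCoin K i (j / m),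
    fun i x => (hasGradientAt_scaledChain (hWd i) a hlam x).differentiableAt, ?_, fun i => ?_,
    fun t ht => ?_⟩
  · rw [havg]
    refine inClass_scaledChain hd hL ha ?_
    rw [ha2, hN]
    push_cast
    linarith
  · refine isStochasticGradient_coinGrad hlam (hWd i) (hW0 i) hP1 _ fun j => ?_
    rw [blockProb_blockCoin, ha2]
    simp only [hW, linkWeights]
    split_ifs with h1 h2 h2
    · exact hvar _ _
    · simp [sq_nonneg]
    · simp only [ne_eq, OfNat.ofNat_ne_zero, not_false_eq_true, zero_pow, mul_zero, zero_mul]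
      positivity
    · simp [sq_nonneg]
  · refine ⟨integrable_bestSqGrad v _ _ t _ hA, ?_⟩
    refine lt_integral_bestSqGrad hv hA _ (gatedBy_coinGrad a (18 * a / L) W (blockProb K p)
      (blockCoin K) m) (p := fun b i => blockProb K p (blockCoin K i b))
      (fun b i => coinLaw_heads _ hP1 _) (T := T) rfl (fun b hb => ?_) hK hε (fun x hx => ?_) ht
    · simp only [blockProb_blockCoin, hb, if_true]
      refine (hwork b).trans (ENNReal.ofReal_le_ofReal ?_)
      linarith
    · rw [havg, (hasGradientAt_scaledChain (firstWeights_of_le hd) a hlam x).gradient, norm_smul,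
        mul_pow, Real.norm_eq_abs, sq_abs, ha2]
      -- The squared norm is at least `32ε / 16 = 2ε`, which fixes the choice of `a`.
      have h := quarter_le_norm_chainGrad (Nat.succ_pos _) hd ((18 * a / L)⁻¹ • x)
        (ext_eq_zero_of_prog_lt (((prog_smul_le _ x).trans hx).trans_lt (Nat.lt_succ_self _)))
      have := pow_le_pow_left₀ (by norm_num) h 2
      nlinarith

end Instance

end TimeOracle

end

/-! ### Choice of the constants -/

theorem theorem5 :
    ∃ c' c₁ c₂ c₃ : ℝ, 0 < c' ∧ 0 < c₁ ∧ 0 < c₂ ∧ 0 < c₃ ∧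
      ∀ (n : ℕ), 0 < n →
      ∀ (v : Fin n → ℝ → ℝ), (∀ i, TimeOracle.IsComputationPower (v i)) →
      ∀ (L Δ ε σ : ℝ), 0 < L → 0 < Δ → 0 < ε → 0 ≤ σ → ε < c' * (L * Δ) →
      -- in every sufficiently large dimension
      ∃ d₀ : ℕ, ∀ d : ℕ, d₀ ≤ d →
      ∀ (A : TimeOracle.Algorithm n d), TimeOracle.IsZeroRespecting A →
      ∃ (f : Fin n → TimeOracle.Vec d → ℝ)
        (Ξ : Type) (_ : MeasurableSpace Ξ) (D : MeasureTheory.Measure Ξ)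
        (_ : MeasureTheory.IsProbabilityMeasure D)
        (g : Fin n → TimeOracle.Vec d → Ξ → NNReal → TimeOracle.Vec d),
        (∀ i, Differentiable ℝ (f i)) ∧
        TimeOracle.InClass L Δ (TimeOracle.average f) ∧
        (∀ i, TimeOracle.IsStochasticGradient σ D (f i) (g i)) ∧
        ∀ t : ENNReal,
          t = TimeOracle.lowerTime v c₂ c₃ (Real.log (L * Δ / ε)) σ ε
                ⌊c₁ * (L * Δ / ε) / Real.log (L * Δ / ε)⌋₊ / 2 →
          -- the draws `ξ 0, ξ 1, …` of the oracles are independent with law `D`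
          MeasureTheory.Integrable
            (TimeOracle.bestSqGrad v g A (TimeOracle.average f) t)
            (MeasureTheory.Measure.infinitePi (fun _ : ℕ => D)) ∧
          ε < ∫ ξ, TimeOracle.bestSqGrad v g A (TimeOracle.average f) t ξ
                ∂(MeasureTheory.Measure.infinitePi (fun _ : ℕ => D)) := by
  refine ⟨1 / 4608, 1 / 41472, 1 / 64, 1, by norm_num, by norm_num, by norm_num, by norm_num, ?_⟩
  intro n hn v hv L Δ ε σ hL _ hε _ hsmall
  set x : ℝ := L * Δ / ε with hx_def
  have hx : 4608 < x := by
    rw [hx_def, lt_div_iff₀ hε]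
    linarith
  have hxε : x * ε = L * Δ := div_mul_cancel₀ _ hε.ne'
  set ℓ : ℝ := Real.log x with hℓ_def
  have hℓ : 1 ≤ ℓ := by
    rw [hℓ_def, Real.le_log_iff_exp_le (by linarith)]
    linarith [Real.exp_one_lt_d9]
  set K : ℕ := ⌊1 / 41472 * x / ℓ⌋₊ with hK_def
  set m : ℕ := ⌈8 * ℓ⌉₊ with hm_def
  have hK : (K : ℝ) * ℓ ≤ 1 / 41472 * x := by
    rw [← le_div_iff₀ (by linarith)]
    exact Nat.floor_le (by positivity)
  have hK0 : (0 : ℝ) ≤ K := Nat.cast_nonneg K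
  have hm : 8 * ℓ ≤ m := Nat.le_ceil _
  have hm' : (m : ℝ) ≤ 9 * ℓ := by linarith [Nat.ceil_lt_add_one (a := 8 * ℓ) (by linarith)]
  -- Each summand takes half of the budget: `2304 ≤ x/2` by `c' = 1/4608`, and `2304 * 9 * K * ℓ ≤
  -- x/2` by `c₁ = 1/41472`.
  have hgap : 2304 * ε * (K * m + 1) ≤ L * Δ := by
    have h1 : (K : ℝ) * m ≤ K * (9 * ℓ) := mul_le_mul_of_nonneg_left hm' hK0
    have h2 : 2304 * ((K : ℝ) * m + 1) ≤ x := by linarith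
    rw [← hxε]
    nlinarith
  have hprob : K * Real.exp (-((m : ℝ) / 4)) < 1 / 2 := by
    -- Here the logarithmic block length is used: `m/4 ≥ 2ℓ ≥ log x` beats the number of blocks in
    -- the union bound.
    have h1 : Real.exp (-((m : ℝ) / 4)) ≤ x⁻¹ := by
      rw [← Real.exp_log (by positivity : (0 : ℝ) < x⁻¹), Real.log_inv, Real.exp_le_exp]
      linarith
    have h2 : (K : ℝ) ≤ 1 / 41472 * x := (le_mul_of_one_le_right hK0 hℓ).trans hK
    calc K * Real.exp (-((m : ℝ) / 4)) ≤ 1 / 41472 * x * x⁻¹ := by gcongr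
      _ = 1 / 41472 := by field_simp
      _ < 1 / 2 := by norm_num
  refine ⟨K * m + 1, fun d hd A hA => ?_⟩
  obtain ⟨f, Ξ, hΞ, D, hD, g, h1, h2, h3, h4⟩ :=
    TimeOracle.exists_hard_instance (σ := σ) hn hv hL hε hℓ hm hgap hprob hd hA
  -- The bound holds up to the full time `t_K`, hence also up to its half.
  exact ⟨f, Ξ, hΞ, D, hD, g, h1, h2, h3, fun t ht => h4 t (ht ▸ ENNReal.half_le_self)⟩
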